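/- Let $M$ be a smooth manifold (Hausdorff, second countable, without boundary, of dimension $n$), let $w\in\Gamma(\Lambda^2 TM)$ be a smooth bivector field, and let $\nabla$ be a smooth torsion-free connection on $TM$ with $\nabla w=0$. Let $\Omega(M)$ be the algebra of smooth real differential forms on $M$, and write $\nabla$ also for the induced connections on $T^*M$ and on $\Lambda(T^*M)$. The quantum exterior product $\wedge_h:\Omega(M)\times\Omega(M)\to\Omega(M)[h]$ is defined fibrewise by $$\alpha\wedge_h\beta=\sum_{k\ge 0}\frac{h^k}{k!}\,m\bigl(L_w^k(\alpha\otimes\beta)\bigr),\qquad L_w(\alpha\otimes\beta)=\sum_{i,j}w^{ij}\,(\alpha\llcorner e_i)\otimes(e_j\lrcorner\beta),$$ where $m$ is the exterior multiplication, $(e_i)$ is a basis of the tangent space with dual basis $(e^i)$, $w^{ij}=w(e^i,e^j)$, and $\alpha\llcorner e$ (resp. $e\lrcorner\beta$) is the contraction of $e$ with the last (resp. first) argument. It is extended $\mathbb R[h]$-bilinearly to $\Omega(M)[h]$ and $\mathbb R[h,h^{-1}]$-bilinearly to $\Omega(M)[h,h^{-1}]$. Both spaces are graded by total degree, where $h$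 has degree $2$. For $\alpha\in\Omega(M)$ put $$d_h\alpha=\sum_i e^i\wedge_h\nabla_{e_i}\alpha .$$ Then $d_h\alpha$ is a well-defined element of $\Omega(M)[h]$, independent of the choice of the bases $(e_i)$, and $d_h$ extends to an $\mathbb R[h]$-linear operator $d_h:\Omega(M)[h]\to\Omega(M)[h]$ and to an $\mathbb R[h,h^{-1}]$-linear operator $d_h:\Omega(M)[h,h^{-1}]\to\Omega(M)[h,h^{-1}]$. Both operators raise the total degree by one and are graded derivations of $\wedge_h$: $$d_h(\alpha\wedge_h\beta)=(d_h\alpha)\wedge_h\beta+(-1)^{|\alpha|}\,\alpha\wedge_h(d_h\beta)$$ for all $\alpha,\beta$ both in $\Omega(M)[h]$ or both in $\Omega(M)[h,h^{-1}]$ with $\alpha$ homogeneous of total degree $|\alpha|$. Furthermore, $d_h^2=0$ on both spaces. -/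

import Mathlib

open Module Bundle Polynomial
open scoped Manifold ContDiff TensorProduct LaurentPolynomial

namespace QuantumDeRham

noncomputable section

/-! ### The quantum exterior product on a vector space -/

section Fiber

variable {V : Type*} [AddCommGroup V] [Module ℝ V]

/-- Contraction from the left of a multi-covector with a vector: `(v ⌟ α)(v₁, …) = α(v, v₁, …)`. -/
def leftContraction (v : V) :
    ExteriorAlgebra ℝ (Dual ℝ V) →ₗ[ℝ] ExteriorAlgebra ℝ (Dual ℝ V) :=
  CliffordAlgebra.contractLeft (Q := (0 : QuadraticForm ℝ (Dual ℝ V))) (Dual.eval ℝ V v)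

/-- Contraction from the right of a multi-covector with a vector:
`(α ⌞ v)(v₁, …, vₖ) = α(v₁, …, vₖ, v)`. -/
def rightContraction (v : V) :
    ExteriorAlgebra ℝ (Dual ℝ V) →ₗ[ℝ] ExteriorAlgebra ℝ (Dual ℝ V) :=
  (CliffordAlgebra.contractRight (Q := (0 : QuadraticForm ℝ (Dual ℝ V)))).flip (Dual.eval ℝ V v)

variable [FiniteDimensional ℝ V]

/-- The operator `L_w (α ⊗ β) = ∑ᵢⱼ wⁱʲ (α ⌞ eᵢ) ⊗ (eⱼ ⌟ β)`, where `wⁱʲ = w(eⁱ, eʲ)`; a bivector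
on `V` is regarded as an (alternating) bilinear form on the dual space of `V`. The operator does
not depend on the basis `(eᵢ)` of `V`. -/
def bivectorContraction (w : LinearMap.BilinForm ℝ (Dual ℝ V)) :
    ExteriorAlgebra ℝ (Dual ℝ V) ⊗[ℝ] ExteriorAlgebra ℝ (Dual ℝ V) →ₗ[ℝ]
      ExteriorAlgebra ℝ (Dual ℝ V) ⊗[ℝ] ExteriorAlgebra ℝ (Dual ℝ V) :=
  ∑ i, ∑ j, w ((finBasis ℝ V).coord i) ((finBasis ℝ V).coord j) •
    TensorProduct.map (rightContraction (finBasis ℝ V i)) (leftContraction (finBasis ℝ V j))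

/-- The coefficient of `h ^ k` in `α ∧_h β = m (exp (h L_w) (α ⊗ β))`, that is
`(1 / k!) m (L_w ^ k (α ⊗ β))`, with `m` the exterior multiplication. -/
def quantumWedgeCoeff (w : LinearMap.BilinForm ℝ (Dual ℝ V)) (k : ℕ)
    (α β : ExteriorAlgebra ℝ (Dual ℝ V)) : ExteriorAlgebra ℝ (Dual ℝ V) :=
  ((k.factorial : ℝ)⁻¹) •
    LinearMap.mul' ℝ (ExteriorAlgebra ℝ (Dual ℝ V)) ((bivectorContraction w ^ k) (α ⊗ₜ[ℝ] β))

/-- The quantum exterior product `Λ(V*) × Λ(V*) → Λ(V*)[h]`,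
`α ∧_h β = ∑ₖ (hᵏ / k!) m (L_w ^ k (α ⊗ β))`. Since more than `dim V` contractions kill `Λ(V*)`,
the sum stops at `k = dim V`. -/
def quantumWedge (w : LinearMap.BilinForm ℝ (Dual ℝ V))
    (α β : ExteriorAlgebra ℝ (Dual ℝ V)) : (ExteriorAlgebra ℝ (Dual ℝ V))[X] :=
  ∑ k ∈ Finset.range (finrank ℝ V + 1), monomial k (quantumWedgeCoeff w k α β)

end Fiber

/-! ### Behaviour of contractions under linear maps -/

section Naturality

variable {V U : Type*} [AddCommGroup V] [Module ℝ V] [AddCommGroup U] [Module ℝ U]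

lemma map_leftContraction (f : U →ₗ[ℝ] V) (u : U) (a : ExteriorAlgebra ℝ (Dual ℝ V)) :
    ExteriorAlgebra.map f.dualMap (leftContraction (f u) a) =
      leftContraction u (ExteriorAlgebra.map f.dualMap a) := by
  unfold leftContraction
  induction a using CliffordAlgebra.left_induction with
  | algebraMap r =>
    rw [CliffordAlgebra.contractLeft_algebraMap, AlgHom.commutes,
      CliffordAlgebra.contractLeft_algebraMap, map_zero]
  | add x y hx hy => simp only [map_add, hx, hy]
  | ι_mul x m hx =>
    have h1 : ExteriorAlgebra.map f.dualMap (CliffordAlgebra.ι 0 m) =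
        CliffordAlgebra.ι 0 (f.dualMap m) := ExteriorAlgebra.map_apply_ι _ _
    rw [CliffordAlgebra.contractLeft_ι_mul, map_sub, map_mul, h1, hx, map_mul, h1,
      CliffordAlgebra.contractLeft_ι_mul, map_smul]
    rfl

lemma map_reverse (f : U →ₗ[ℝ] V) (a : ExteriorAlgebra ℝ (Dual ℝ V)) :
    ExteriorAlgebra.map f.dualMap (CliffordAlgebra.reverse a) =
      CliffordAlgebra.reverse (ExteriorAlgebra.map f.dualMap a) := by
  induction a using CliffordAlgebra.left_induction with
  | algebraMap r =>
    rw [CliffordAlgebra.reverse.commutes, AlgHom.commutes, CliffordAlgebra.reverse.commutes]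
  | add x y hx hy => simp only [map_add, hx, hy]
  | ι_mul x m hx =>
    have h1 : ExteriorAlgebra.map f.dualMap (CliffordAlgebra.ι 0 m) =
        CliffordAlgebra.ι 0 (f.dualMap m) := ExteriorAlgebra.map_apply_ι _ _
    rw [CliffordAlgebra.reverse.map_mul, map_mul, hx, CliffordAlgebra.reverse_ι, h1, map_mul, h1,
      CliffordAlgebra.reverse.map_mul, CliffordAlgebra.reverse_ι]

lemma map_rightContraction (f : U →ₗ[ℝ] V) (u : U) (a : ExteriorAlgebra ℝ (Dual ℝ V)) :
    ExteriorAlgebra.map f.dualMap (rightContraction (f u) a) =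
      rightContraction u (ExteriorAlgebra.map f.dualMap a) := by
  have h := map_leftContraction f u (CliffordAlgebra.reverse a)
  unfold leftContraction at h
  simp only [rightContraction, LinearMap.flip_apply, CliffordAlgebra.contractRight_eq]
  rw [map_reverse, h, map_reverse]

lemma sum_coord_basis {ι κ N : Type*} [Fintype ι] [Fintype κ] [AddCommGroup N] [Module ℝ N]
    (G : Dual ℝ V →ₗ[ℝ] V →ₗ[ℝ] N) (b : Basis ι ℝ V) (c : Basis κ ℝ V) :
    ∑ i, G (b.coord i) (b i) = ∑ k, G (c.coord k) (c k) := by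
  classical
  have hc (k : κ) : c.coord k = ∑ i, c.coord k (b i) • b.coord i := by
    refine b.ext fun l => ?_
    simp [Finsupp.single_apply]
  calc ∑ i, G (b.coord i) (b i)
      = ∑ i, ∑ k, c.coord k (b i) • G (b.coord i) (c k) := by
        refine Finset.sum_congr rfl fun i _ => ?_
        conv_lhs => rw [← c.sum_repr (b i)]
        simp only [map_sum, map_smul, Basis.coord_apply]
    _ = ∑ k, ∑ i, c.coord k (b i) • G (b.coord i) (c k) := Finset.sum_comm
    _ = ∑ k, G (c.coord k) (c k) := by
        refine Finset.sum_congr rfl fun k _ => ?_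
        conv_rhs => rw [hc k]
        simp

lemma bivectorContraction_eq [FiniteDimensional ℝ V] {ι : Type*} [Fintype ι]
    (w : LinearMap.BilinForm ℝ (Dual ℝ V))
    (b : Basis ι ℝ V) :
    bivectorContraction w = ∑ i, ∑ j, w (b.coord i) (b.coord j) •
      TensorProduct.map (rightContraction (b i)) (leftContraction (b j)) := by
  have hLa (v v' : V) : leftContraction (v + v') = leftContraction v + leftContraction v' := by
    unfold leftContraction; rw [map_add, map_add]
  have hLs (r : ℝ) (v : V) : leftContraction (r • v) = r • leftContraction v := by
    unfold leftContraction; rw [map_smul, map_smul]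
  have hRa (v v' : V) : rightContraction (v + v') = rightContraction v + rightContraction v' := by
    unfold rightContraction; rw [map_add, map_add]
  have hRs (r : ℝ) (v : V) : rightContraction (r • v) = r • rightContraction v := by
    unfold rightContraction; rw [map_smul, map_smul]
  have h1 (ψ : Dual ℝ V) (v : V) := sum_coord_basis (LinearMap.mk₂ ℝ
    (fun (φ : Dual ℝ V) (u : V) => w ψ φ •
      TensorProduct.map (rightContraction v) (leftContraction u))
    (by intros; rw [map_add, add_smul]) (by intros; rw [map_smul, smul_assoc])
    (by intros; rw [hLa, TensorProduct.map_add_right, smul_add])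
    (by intros; rw [hLs, TensorProduct.map_smul_right, smul_comm])) (finBasis ℝ V) b
  have h2 (ψ : Dual ℝ V) (v : V) := sum_coord_basis (LinearMap.mk₂ ℝ
    (fun (φ : Dual ℝ V) (u : V) => w φ ψ •
      TensorProduct.map (rightContraction u) (leftContraction v))
    (by intros; rw [map_add, LinearMap.add_apply, add_smul])
    (by intros; rw [map_smul, LinearMap.smul_apply, smul_assoc])
    (by intros; rw [hRa, TensorProduct.map_add_left, smul_add])
    (by intros; rw [hRs, TensorProduct.map_smul_left, smul_comm])) (finBasis ℝ V) b
  simp only [LinearMap.mk₂_apply] at h1 h2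
  unfold bivectorContraction
  simp only [h1]
  rw [Finset.sum_comm]
  simp only [h2]
  exact Finset.sum_comm

end Naturality

/-! ### Differential forms on a manifold -/

section Manifold

variable {E : Type*} [NormedAddCommGroup E] [NormedSpace ℝ E] [FiniteDimensional ℝ E]
  {M : Type*} [TopologicalSpace M] [ChartedSpace E M] [IsManifold 𝓘(ℝ, E) ∞ M]

instance (x : M) : FiniteDimensional ℝ (TangentSpace 𝓘(ℝ, E) x) :=
  inferInstanceAs (FiniteDimensional ℝ E)

variable (E) in
/-- The exterior algebra `Λ(T*ₓM)`. -/
abbrev CotangentAlgebra (x : M) : Type _ :=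
  ExteriorAlgebra ℝ (Dual ℝ (TangentSpace 𝓘(ℝ, E) x))

variable (E) in
/-- The `j`-th vector field `e_j` of the local frame of `TM` induced by the preferred chart
at `x₀`. -/
def frame (x₀ : M) (j : Fin (finrank ℝ E)) (y : M) : TangentSpace 𝓘(ℝ, E) y :=
  (trivializationAt E (TangentSpace 𝓘(ℝ, E) : M → Type _) x₀).symmL ℝ y (finBasis ℝ E j)

variable (E) in
/-- The `j`-th covector field `e^j` of the local coframe of `T*M` dual to `frame E x₀`. -/
def coframe (x₀ : M) (j : Fin (finrank ℝ E)) (y : M) : Dual ℝ (TangentSpace 𝓘(ℝ, E) y) :=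
  (finBasis ℝ E).coord j ∘ₗ
    ((trivializationAt E (TangentSpace 𝓘(ℝ, E) : M → Type _) x₀).continuousLinearMapAt ℝ y :
      TangentSpace 𝓘(ℝ, E) y →ₗ[ℝ] E)

variable (E) in
/-- The basis of the exterior algebra `Λ(E*)` of the model space which consists of the
products `b^{i₁} ∧ ⋯ ∧ b^{iₖ}`, `I = {i₁ < ⋯ < iₖ}`, of members of the dual of the chosen basis. -/
def modelBasis : Basis (Finset (Fin (finrank ℝ E))) ℝ (ExteriorAlgebra ℝ (Dual ℝ E)) :=
  (finBasis ℝ E).dualBasis.ExteriorAlgebra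

variable (E) in
/-- The isomorphism `Λ(T*_yM) → Λ(E*)` which is induced by the preferred chart at `x₀`
(for `y` in the domain of this chart). -/
def toModel (x₀ y : M) : CotangentAlgebra E y →ₐ[ℝ] ExteriorAlgebra ℝ (Dual ℝ E) :=
  ExteriorAlgebra.map
    ((trivializationAt E (TangentSpace 𝓘(ℝ, E) : M → Type _) x₀).symmL ℝ y :
      E →ₗ[ℝ] TangentSpace 𝓘(ℝ, E) y).dualMap

variable (E) in
/-- The inverse `Λ(E*) → Λ(T*_yM)` of `toModel E x₀ y`. -/
def ofModel (x₀ y : M) : ExteriorAlgebra ℝ (Dual ℝ E) →ₐ[ℝ] CotangentAlgebra E y :=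
  ExteriorAlgebra.map
    ((trivializationAt E (TangentSpace 𝓘(ℝ, E) : M → Type _) x₀).continuousLinearMapAt ℝ y :
      TangentSpace 𝓘(ℝ, E) y →ₗ[ℝ] E).dualMap

/-- The component `α_I` of `α` with respect to the coframe `(e^j)` induced by the preferred chart
at `x₀`: near `x₀` one has `α = ∑_I α_I e^I`, `e^I = e^{i₁} ∧ ⋯ ∧ e^{iₖ}`, `i₁ < ⋯ < iₖ`. -/
def component (x₀ : M) (I : Finset (Fin (finrank ℝ E))) (α : ∀ y : M, CotangentAlgebra E y)
    (y : M) : ℝ :=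
  (modelBasis E).repr (toModel E x₀ y (α y)) I

/-- A (not necessarily homogeneous) form is smooth at `x₀` if so are its components. -/
def SmoothFormAt (α : ∀ y : M, CotangentAlgebra E y) (x₀ : M) : Prop :=
  ∀ I, ContMDiffAt 𝓘(ℝ, E) 𝓘(ℝ) ∞ (component x₀ I α) x₀

variable (E M) in
/-- A smooth bivector field `w ∈ Γ(Λ²TM)`; its value at `x` is regarded as an alternating bilinear
form on `T*ₓM`. -/
structure BivectorField where
  /-- The value of the bivector field at a point. -/
  toFun : ∀ x : M, LinearMap.BilinForm ℝ (Dual ℝ (TangentSpace 𝓘(ℝ, E) x))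
  isAlt : ∀ x, (toFun x).IsAlt
  smooth : ∀ (x₀ : M) (i j : Fin (finrank ℝ E)), ContMDiffAt 𝓘(ℝ, E) 𝓘(ℝ) ∞
    (fun y => toFun y (coframe E x₀ i y) (coframe E x₀ j y)) x₀

section Smoothness

set_option linter.unusedSectionVars false

variable {W W' : Type*} [AddCommGroup W] [Module ℝ W] [AddCommGroup W'] [Module ℝ W']
  {x₀ : M} {f : M → W} {g : M → W'}

variable (E) in
/-- Smoothness at `x₀` of a function with values in a finite-dimensional vector space. -/
def WeakSmoothAt (f : M → W) (x₀ : M) : Prop :=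
  ∀ l : Dual ℝ W, ContMDiffAt 𝓘(ℝ, E) 𝓘(ℝ) ∞ (fun y => l (f y)) x₀

lemma WeakSmoothAt.map (hf : WeakSmoothAt E f x₀) (A : W →ₗ[ℝ] W') :
    WeakSmoothAt E (fun y => A (f y)) x₀ :=
  fun l => hf (l ∘ₗ A)

lemma WeakSmoothAt.smul (hf : WeakSmoothAt E f x₀) {c : M → ℝ}
    (hc : ContMDiffAt 𝓘(ℝ, E) 𝓘(ℝ) ∞ c x₀) : WeakSmoothAt E (fun y => c y • f y) x₀ := by
  intro l
  simp only [map_smul, smul_eq_mul]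
  exact hc.mul (hf l)

lemma WeakSmoothAt.sum {ι : Type*} {s : Finset ι} {F : ι → M → W}
    (hF : ∀ i ∈ s, WeakSmoothAt E (F i) x₀) : WeakSmoothAt E (fun y => ∑ i ∈ s, F i y) x₀ := by
  intro l
  simp only [map_sum]
  exact contMDiffAt_finsetSum fun i hi => hF i hi l

lemma WeakSmoothAt.tmul {ι : Type*} [Fintype ι] (b : Basis ι ℝ W) (hf : WeakSmoothAt E f x₀)
    (hg : WeakSmoothAt E g x₀) : WeakSmoothAt E (fun y => f y ⊗ₜ[ℝ] g y) x₀ := by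
  have h : (fun y => f y ⊗ₜ[ℝ] g y) =
      fun y => ∑ i, b.coord i (f y) • TensorProduct.mk ℝ W W' (b i) (g y) := by
    funext y
    conv_lhs => rw [← b.sum_repr (f y), TensorProduct.sum_tmul]
    simp only [TensorProduct.smul_tmul', Basis.coord_apply, TensorProduct.mk_apply]
  rw [h]
  exact WeakSmoothAt.sum fun i _ => (hg.map (TensorProduct.mk ℝ W W' (b i))).smul (hf (b.coord i))

lemma WeakSmoothAt.congr {f' : M → W} (hf : WeakSmoothAt E f x₀)
    (h : ∀ᶠ y in nhds x₀, f' y = f y) : WeakSmoothAt E f' x₀ :=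
  fun l => (hf l).congr_of_eventuallyEq (h.mono fun y hy => by simp only [hy])

lemma smoothFormAt_iff {α : ∀ y : M, CotangentAlgebra E y} :
    SmoothFormAt α x₀ ↔ WeakSmoothAt E (fun y => toModel E x₀ y (α y)) x₀ := by
  refine ⟨fun h l => ?_, fun h I => h ((modelBasis E).coord I)⟩
  have h2 : (fun y => l (toModel E x₀ y (α y))) =
      fun y => ∑ I, component x₀ I α y * l (modelBasis E I) := by
    funext y
    conv_lhs => rw [← (modelBasis E).sum_repr (toModel E x₀ y (α y)), map_sum]
    simp only [map_smul, smul_eq_mul, component]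
  rw [h2]
  exact contMDiffAt_finsetSum fun I _ => (h I).mul contMDiffAt_const

lemma toModel_bivectorContraction (w : BivectorField E M) (x₀ : M) {y : M}
    (hy : y ∈ (trivializationAt E (TangentSpace 𝓘(ℝ, E) : M → Type _) x₀).baseSet)
    (t : CotangentAlgebra E y ⊗[ℝ] CotangentAlgebra E y) :
    TensorProduct.map (toModel E x₀ y).toLinearMap (toModel E x₀ y).toLinearMap
        (bivectorContraction (w.toFun y) t) =
      ∑ i, ∑ j, w.toFun y (coframe E x₀ i y) (coframe E x₀ j y) •
        TensorProduct.map (rightContraction (finBasis ℝ E i)) (leftContraction (finBasis ℝ E j))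
          (TensorProduct.map (toModel E x₀ y).toLinearMap (toModel E x₀ y).toLinearMap t) := by
  let b : Basis (Fin (finrank ℝ E)) ℝ (TangentSpace 𝓘(ℝ, E) y) :=
    (finBasis ℝ E).map ((trivializationAt E (TangentSpace 𝓘(ℝ, E) : M → Type _)
      x₀).continuousLinearEquivAt ℝ y hy).symm.toLinearEquiv
  have hb (i) : b i = (trivializationAt E (TangentSpace 𝓘(ℝ, E) : M → Type _) x₀).symmL ℝ y
      (finBasis ℝ E i) := by
    rw [Trivialization.symmL_apply _ hy]
    simp [b]
  have hc (i) : b.coord i = coframe E x₀ i y := by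
    ext v
    simp [b, coframe, Trivialization.coe_linearMapAt_of_mem _ hy]
  rw [bivectorContraction_eq _ b]
  induction t with
  | zero => simp
  | add t s ht hs => simp only [map_add, ht, hs, smul_add, Finset.sum_add_distrib]
  | tmul p q =>
    simp only [LinearMap.sum_apply, LinearMap.smul_apply, map_sum, map_smul,
      TensorProduct.map_tmul, hb, hc, AlgHom.toLinearMap_apply]
    refine Finset.sum_congr rfl fun i _ => Finset.sum_congr rfl fun j _ => ?_
    congr 2
    · exact map_rightContraction _ _ _
    · exact map_leftContraction _ _ _

lemma SmoothFormAt.quantumWedgeCoeff (w : BivectorField E M) (k : ℕ)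
    {α β : ∀ y : M, CotangentAlgebra E y} (hα : SmoothFormAt α x₀) (hβ : SmoothFormAt β x₀) :
    SmoothFormAt (fun y => quantumWedgeCoeff (w.toFun y) k (α y) (β y)) x₀ := by
  rw [smoothFormAt_iff] at *
  have key (n : ℕ) : WeakSmoothAt E (fun y =>
      TensorProduct.map (toModel E x₀ y).toLinearMap (toModel E x₀ y).toLinearMap
        ((bivectorContraction (w.toFun y) ^ n) (α y ⊗ₜ[ℝ] β y))) x₀ := by
    induction n with
    | zero =>
      simp only [pow_zero, Module.End.one_apply, TensorProduct.map_tmul]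
      exact WeakSmoothAt.tmul (modelBasis E) hα hβ
    | succ n ih =>
      refine WeakSmoothAt.congr (f := fun y => ∑ i, ∑ j,
        w.toFun y (coframe E x₀ i y) (coframe E x₀ j y) •
          TensorProduct.map (rightContraction (finBasis ℝ E i)) (leftContraction (finBasis ℝ E j))
            (TensorProduct.map (toModel E x₀ y).toLinearMap (toModel E x₀ y).toLinearMap
              ((bivectorContraction (w.toFun y) ^ n) (α y ⊗ₜ[ℝ] β y)))) ?_ ?_
      rotate_left
      · have hmem := (trivializationAt E (TangentSpace 𝓘(ℝ, E) : M → Type _)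
          x₀).open_baseSet.mem_nhds (FiberBundle.mem_baseSet_trivializationAt' x₀)
        filter_upwards [hmem] with y hy
        rw [pow_succ', Module.End.mul_apply, toModel_bivectorContraction w x₀ hy]
      · exact WeakSmoothAt.sum fun i _ => WeakSmoothAt.sum fun j _ =>
          (ih.map _).smul (w.smooth x₀ i j)
  refine ((key k).map (((k.factorial : ℝ)⁻¹) • LinearMap.mul' ℝ _)).congr
    (Filter.Eventually.of_forall fun y => ?_)
  simp only [QuantumDeRham.quantumWedgeCoeff, map_smul, LinearMap.smul_apply]
  congr 1
  generalize (bivectorContraction (w.toFun y) ^ k) (α y ⊗ₜ[ℝ] β y) = t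
  induction t with
  | zero => simp
  | add t s ht hs => simp only [map_add, ht, hs]
  | tmul p q => simp

end Smoothness

variable (E M) in
/-- The algebra `Ω(M)` of smooth differential forms on `M`, with the exterior product. -/
def Forms : Subalgebra ℝ (∀ y : M, CotangentAlgebra E y) where
  carrier := {α | ∀ x₀, SmoothFormAt α x₀}
  mul_mem' {α β} hα hβ x₀ := by
    have h1 := smoothFormAt_iff.1 (hα x₀)
    have h2 := smoothFormAt_iff.1 (hβ x₀)
    refine smoothFormAt_iff.2 (((h1.tmul (modelBasis E) h2).map (LinearMap.mul' ℝ _)).congr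
      (Filter.Eventually.of_forall fun y => ?_))
    simp
  add_mem' {α β} hα hβ x₀ I := by
    have h : component x₀ I (α + β) = fun y => component x₀ I α y + component x₀ I β y := by
      funext y
      simp [component]
    rw [h]
    exact (hα x₀ I).add (hβ x₀ I)
  algebraMap_mem' r x₀ I := by
    have h : component x₀ I (algebraMap ℝ (∀ y : M, CotangentAlgebra E y) r) =
        fun _ => (modelBasis E).repr (algebraMap ℝ _ r) I := by
      funext y
      simp [component]
    rw [h]
    exact contMDiffAt_const

variable (E) in
/-- The value `Ω(M) → Λ(T*ₓM)` of a form at `x`. -/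
def valueAt (x : M) : Forms E M →+* CotangentAlgebra E x :=
  (Pi.evalRingHom (CotangentAlgebra E) x).comp (Forms E M).val.toRingHom

/-- The quantum exterior product `Ω(M) × Ω(M) → Ω(M)[h]`, the fibrewise quantum exterior product
of differential forms. -/
def formWedge (w : BivectorField E M) (α β : Forms E M) : (Forms E M)[X] :=
  ∑ k ∈ Finset.range (finrank ℝ E + 1), monomial k
    ⟨fun y => quantumWedgeCoeff (w.toFun y) k (α.1 y) (β.1 y),
      fun x₀ => (α.2 x₀).quantumWedgeCoeff w k (β.2 x₀)⟩

/-- The `ℝ[h]`-bilinear extension of the quantum exterior product to `Ω(M)[h]`. -/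
def polyWedge (w : BivectorField E M) (p q : (Forms E M)[X]) : (Forms E M)[X] :=
  p.sum fun i α => q.sum fun j β => formWedge w α β * X ^ (i + j)

/-- The `ℝ[h, h⁻¹]`-bilinear extension of the quantum exterior product to `Ω(M)[h, h⁻¹]`. -/
def laurentWedge (w : BivectorField E M) (p q : (Forms E M)[T;T⁻¹]) : (Forms E M)[T;T⁻¹] :=
  p.coeff.sum fun i α => q.coeff.sum fun j β =>
    toLaurent (formWedge w α β) * LaurentPolynomial.T (i + j)

/-- The space `Ωᵈ(M)` of forms of degree `d`; it is zero for negative `d`. -/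
def IsOfDegree : ℤ → Forms E M → Prop
  | .ofNat d, α => ∀ x, α.1 x ∈ ⋀[ℝ]^d (Dual ℝ (TangentSpace 𝓘(ℝ, E) x))
  | .negSucc _, α => α = 0

/-- Elements of `Ω(M)[h]` of total degree `m`, where `h` has degree `2`. -/
def IsPolyHomogeneous (m : ℤ) (p : (Forms E M)[X]) : Prop :=
  ∀ k : ℕ, IsOfDegree (m - 2 * k) (p.coeff k)

/-- Elements of `Ω(M)[h, h⁻¹]` of total degree `m`, where `h` has degree `2`. -/
def IsLaurentHomogeneous (m : ℤ) (p : (Forms E M)[T;T⁻¹]) : Prop :=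
  ∀ k : ℤ, IsOfDegree (m - 2 * k) (p.coeff k)

/-! ### Connections -/

/-- The connection on `T*M` induced by a connection on `TM`:
`(∇_v θ)(e_j) = v(θ(e_j)) - θ(∇_v e_j)` for the members `e_j` of a local frame around `x`. -/
def cotangentConnection (cov : CovariantDerivative 𝓘(ℝ, E) E (TangentSpace 𝓘(ℝ, E) : M → Type _))
    (θ : ∀ y : M, Dual ℝ (TangentSpace 𝓘(ℝ, E) y)) (x : M) (v : TangentSpace 𝓘(ℝ, E) x) :
    Dual ℝ (TangentSpace 𝓘(ℝ, E) x) :=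
  ∑ j, (mvfderiv 𝓘(ℝ, E) (fun y => θ y (frame E x j y)) x v - θ x (cov (frame E x j) x v)) •
    coframe E x j x

/-- The connection on `Λ(T*M)` induced by a connection on `TM`, i.e. the extension of the induced
connection on `T*M` as a derivation of the exterior product. If `α = ∑_I α_I e^I`
in the coframe of the chart at `x`, then
`∇_v α = ∑_I v(α_I) e^I + ∑_I α_I ∇_v e^I` and, by the Leibniz rule,
`∇_v e^I = ∑ⱼ (∇_v e^j) ∧ (e_j ⌟ e^I)`. -/
def formConnection (cov : CovariantDerivative 𝓘(ℝ, E) E (TangentSpace 𝓘(ℝ, E) : M → Type _))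
    (α : ∀ y : M, CotangentAlgebra E y) (x : M) (v : TangentSpace 𝓘(ℝ, E) x) :
    CotangentAlgebra E x :=
  ∑ I, mvfderiv 𝓘(ℝ, E) (component x I α) x v • ofModel E x x (modelBasis E I) +
    ∑ j, ExteriorAlgebra.ι ℝ (cotangentConnection cov (coframe E x j) x v) *
      leftContraction (frame E x j x) (α x)

/-- The connection preserves the bivector field, `∇w = 0`: for covector fields `θ`, `η` which are
smooth at `x`, `v(w(θ, η)) = w(∇_v θ, η) + w(θ, ∇_v η)`. -/
def BivectorField.IsParallel (w : BivectorField E M)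
    (cov : CovariantDerivative 𝓘(ℝ, E) E (TangentSpace 𝓘(ℝ, E) : M → Type _)) : Prop :=
  ∀ (x : M) (v : TangentSpace 𝓘(ℝ, E) x) (θ η : ∀ y : M, Dual ℝ (TangentSpace 𝓘(ℝ, E) y)),
    SmoothFormAt (fun y => ExteriorAlgebra.ι ℝ (θ y)) x →
    SmoothFormAt (fun y => ExteriorAlgebra.ι ℝ (η y)) x →
    mvfderiv 𝓘(ℝ, E) (fun y => w.toFun y (θ y) (η y)) x v =
      w.toFun x (cotangentConnection cov θ x v) (η x) +
        w.toFun x (θ x) (cotangentConnection cov η x v)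

/-- The value at `x` of `d_h α = ∑ᵢ eⁱ ∧_h ∇_{eᵢ} α`, calculated in a basis `(eᵢ)` of `TₓM`. -/
def quantumDifferentialAt (w : BivectorField E M)
    (cov : CovariantDerivative 𝓘(ℝ, E) E (TangentSpace 𝓘(ℝ, E) : M → Type _))
    (α : Forms E M) (x : M) {ι : Type*} [Fintype ι] (e : Basis ι ℝ (TangentSpace 𝓘(ℝ, E) x)) :
    (CotangentAlgebra E x)[X] :=
  ∑ i, quantumWedge (w.toFun x) (ExteriorAlgebra.ι ℝ (e.coord i))
    (formConnection cov α.1 x (e i))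

end Manifold

end

end QuantumDeRham

open QuantumDeRham

/-! Let Λ be the insertion of the bivector, Λ = ½ ∑ wⁱʲ e_j ⌟ e_i ⌟. It is a second-order operator
on the exterior algebra, and its failure to be a derivation is exactly L_w: m ∘ L_w = Λ ∘ m - m ∘ (Λ
⊗ 1) - m ∘ (1 ⊗ Λ) (`bivectorInsertion_mul`). As L_w commutes with Λ ⊗ 1 and 1 ⊗ Λ, formally α ∧_h β
= e^{hΛ}(e^{-hΛ}α ∧ e^{-hΛ}β): the quantum product is the exterior product conjugated by e^{hΛ}.

The quantum differential is the exterior derivative conjugated in the same way. Torsion-freeness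
gives d = ∑ eⁱ ∧ ∇_{e_i} (`extD_eq_sum_formConnection`), and ∇w = 0 gives [∇, Λ] = 0
(`formConnection_bivectorInsertion`). A covector admits only one contraction, so d_h = d + hδ, and
its h-part is δ = [Λ, d]. For the same reason [Λ, [Λ, eⁱ ∧ ·]] = 0, hence [Λ, δ] = 0
(`formInsertion_codifferential`), and formally d_h = e^{hΛ} d e^{-hΛ}. The Leibniz rule and d_h² = 0
are therefore those of d.

The exponential is not used. The conjugation of the product is encoded in the recurrence
`succ_smul_quantumWedgeCoeff` for the coefficients of hᵏ, the Leibniz rule follows by induction on k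
(`formWedgeCoeff_leibniz`), and d_h² = 0 splits into d² = 0, dδ + δd = 0 and δ² = 0. The exterior
derivative is built in charts, its independence of the chart resting on the symmetry of second
derivatives. Results over h, h⁻¹ follow from those over h by clearing denominators. -/

namespace QuantumDeRham

noncomputable section

/-! ### Multilinear algebra on a single vector space. -/

section Fiber

variable {V : Type*} [AddCommGroup V] [Module ℝ V]

/-- The grade involution of `Λ(V*)`. -/
abbrev gradeInvolution : ExteriorAlgebra ℝ (Dual ℝ V) →ₐ[ℝ] ExteriorAlgebra ℝ (Dual ℝ V) :=
  CliffordAlgebra.involute (Q := (0 : QuadraticForm ℝ (Dual ℝ V)))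

lemma gradeInvolution_ι (θ : Dual ℝ V) :
    gradeInvolution (ExteriorAlgebra.ι ℝ θ) = -ExteriorAlgebra.ι ℝ θ :=
  CliffordAlgebra.involute_ι θ

lemma gradeInvolution_gradeInvolution (a : ExteriorAlgebra ℝ (Dual ℝ V)) :
    gradeInvolution (gradeInvolution a) = a :=
  CliffordAlgebra.involute_involute a

lemma leftContraction_ι_mul (v : V) (θ : Dual ℝ V) (b : ExteriorAlgebra ℝ (Dual ℝ V)) :
    leftContraction v (ExteriorAlgebra.ι ℝ θ * b) =
      θ v • b - ExteriorAlgebra.ι ℝ θ * leftContraction v b :=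
  CliffordAlgebra.contractLeft_ι_mul _ _ _

lemma leftContraction_algebraMap (v : V) (r : ℝ) :
    leftContraction v (algebraMap ℝ (ExteriorAlgebra ℝ (Dual ℝ V)) r) = 0 :=
  CliffordAlgebra.contractLeft_algebraMap _ _ _

lemma leftContraction_ι (v : V) (θ : Dual ℝ V) :
    leftContraction v (ExteriorAlgebra.ι ℝ θ) = algebraMap ℝ _ (θ v) :=
  CliffordAlgebra.contractLeft_ι _ _ _

lemma leftContraction_comm (u v : V) (a : ExteriorAlgebra ℝ (Dual ℝ V)) :
    leftContraction u (leftContraction v a) = -leftContraction v (leftContraction u a) :=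
  CliffordAlgebra.contractLeft_comm _ _ _

lemma leftContraction_add (u v : V) :
    leftContraction (u + v) = leftContraction u + leftContraction v := by
  unfold leftContraction; rw [map_add, map_add]

lemma leftContraction_smul (r : ℝ) (v : V) :
    leftContraction (r • v) = r • leftContraction v := by
  unfold leftContraction; rw [map_smul, map_smul]

/-- Induction on elements of `Λ(V*)`, by multiplication with covectors from the left. -/
lemma exterior_induction {P : ExteriorAlgebra ℝ (Dual ℝ V) → Prop}
    (a : ExteriorAlgebra ℝ (Dual ℝ V)) (scalar : ∀ r, P (algebraMap ℝ _ r))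
    (add : ∀ x y, P x → P y → P (x + y))
    (ι_mul : ∀ θ x, P x → P (ExteriorAlgebra.ι ℝ θ * x)) : P a :=
  CliffordAlgebra.left_induction (Q := (0 : QuadraticForm ℝ (Dual ℝ V))) scalar add
    (fun x m h => ι_mul m x h) a

lemma leftContraction_gradeInvolution (v : V) (a : ExteriorAlgebra ℝ (Dual ℝ V)) :
    leftContraction v (gradeInvolution a) = -gradeInvolution (leftContraction v a) := by
  induction a using exterior_induction with
  | scalar r => rw [AlgHom.commutes, leftContraction_algebraMap, map_zero, neg_zero]
  | add x y hx hy => simp only [map_add, hx, hy, neg_add]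
  | ι_mul θ x hx =>
    rw [map_mul, gradeInvolution_ι, neg_mul, map_neg, leftContraction_ι_mul,
      leftContraction_ι_mul, hx, map_sub, map_smul, map_mul, gradeInvolution_ι]
    simp

lemma leftContraction_mul (v : V) (a b : ExteriorAlgebra ℝ (Dual ℝ V)) :
    leftContraction v (a * b) = leftContraction v a * b +
      gradeInvolution a * leftContraction v b := by
  induction a using exterior_induction with
  | scalar r =>
    rw [AlgHom.commutes, leftContraction_algebraMap, zero_mul, zero_add, ← Algebra.smul_def,
      ← Algebra.smul_def, map_smul]
  | add x y hx hy => simp only [map_add, add_mul, hx, hy]; abel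
  | ι_mul θ x hx =>
    rw [mul_assoc, leftContraction_ι_mul, hx, leftContraction_ι_mul, map_mul, gradeInvolution_ι,
      sub_mul, mul_add, smul_mul_assoc, neg_mul, neg_mul, mul_assoc, mul_assoc]
    abel

/-- In degree p, moving the vector from the last slot to the first passes p - 1 arguments, and
(-1)^(p-1) is how the involution acts on the contracted form. All later computations thereby need
left contractions only. -/
lemma rightContraction_eq (v : V) (a : ExteriorAlgebra ℝ (Dual ℝ V)) :
    rightContraction v a = gradeInvolution (leftContraction v a) := by
  have h1 (r : ℝ) : rightContraction v (algebraMap ℝ (ExteriorAlgebra ℝ (Dual ℝ V)) r) = 0 :=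
    CliffordAlgebra.contractRight_algebraMap _ _ _
  have h2 (x : ExteriorAlgebra ℝ (Dual ℝ V)) (θ : Dual ℝ V) :
      rightContraction v (x * ExteriorAlgebra.ι ℝ θ) =
        θ v • x - rightContraction v x * ExteriorAlgebra.ι ℝ θ :=
    CliffordAlgebra.contractRight_mul_ι _ _ _
  refine CliffordAlgebra.right_induction (Q := (0 : QuadraticForm ℝ (Dual ℝ V)))
    (P := fun a => rightContraction v a = gradeInvolution (leftContraction v a)) ?_ ?_ ?_ a
  · intro r
    rw [h1, leftContraction_algebraMap, map_zero]
  · intro x y hx hy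
    simp only [map_add, hx, hy]
  · intro θ x hx
    refine (h2 x θ).trans ?_
    change _ = gradeInvolution (leftContraction v (x * ExteriorAlgebra.ι ℝ θ))
    rw [leftContraction_mul, map_add, map_mul, map_mul, gradeInvolution_gradeInvolution,
      gradeInvolution_ι, leftContraction_ι, AlgHom.commutes, hx, mul_neg,
      ← Algebra.commutes, ← Algebra.smul_def]
    abel

/-! ### Contractions and the degree -/

/-- The second clause is needed because `p - 1` is truncated: for `p = 0` the first clause alone
would only give a scalar. -/
lemma leftContraction_mem_exteriorPower (v : V) (p : ℕ) {a : ExteriorAlgebra ℝ (Dual ℝ V)}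
    (ha : a ∈ ⋀[ℝ]^p (Dual ℝ V)) :
    leftContraction v a ∈ ⋀[ℝ]^(p - 1) (Dual ℝ V) ∧ (p = 0 → leftContraction v a = 0) := by
  induction p generalizing a with
  | zero =>
    rw [ExteriorAlgebra.exteriorPower, pow_zero, Submodule.mem_one] at ha
    obtain ⟨r, rfl⟩ := ha
    rw [leftContraction_algebraMap]
    exact ⟨zero_mem _, fun _ => rfl⟩
  | succ p ih =>
    refine ⟨?_, by simp⟩
    rw [ExteriorAlgebra.exteriorPower, pow_succ'] at ha
    induction ha using Submodule.mul_induction_on' with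
    | mem_mul_mem m hm x hx =>
      obtain ⟨θ, rfl⟩ := hm
      rw [leftContraction_ι_mul]
      refine sub_mem (Submodule.smul_mem _ _ hx) ?_
      rcases p with _ | p
      · rw [(ih hx).2 rfl, mul_zero]
        exact zero_mem _
      · change _ ∈ LinearMap.range (ExteriorAlgebra.ι ℝ) ^ (p + 1)
        rw [pow_succ']
        exact Submodule.mul_mem_mul ⟨θ, rfl⟩ (ih hx).1
    | add x _ y _ hx hy =>
      rw [map_add]
      exact add_mem hx hy

lemma gradeInvolution_of_mem {p : ℕ} {a : ExteriorAlgebra ℝ (Dual ℝ V)}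
    (ha : a ∈ ⋀[ℝ]^p (Dual ℝ V)) : gradeInvolution a = (-1 : ℝ) ^ p • a := by
  induction p generalizing a with
  | zero =>
    rw [ExteriorAlgebra.exteriorPower, pow_zero, Submodule.mem_one] at ha
    obtain ⟨r, rfl⟩ := ha
    rw [AlgHom.commutes, pow_zero, one_smul]
  | succ p ih =>
    rw [ExteriorAlgebra.exteriorPower, pow_succ'] at ha
    induction ha using Submodule.mul_induction_on' with
    | mem_mul_mem m hm x hx =>
      obtain ⟨θ, rfl⟩ := hm
      rw [map_mul, gradeInvolution_ι, ih hx, pow_succ']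
      simp
    | add x _ y _ hx hy => rw [map_add, hx, hy, smul_add]

lemma rightContraction_mem_exteriorPower (v : V) (p : ℕ) {a : ExteriorAlgebra ℝ (Dual ℝ V)}
    (ha : a ∈ ⋀[ℝ]^p (Dual ℝ V)) :
    rightContraction v a ∈ ⋀[ℝ]^(p - 1) (Dual ℝ V) ∧ (p = 0 → rightContraction v a = 0) := by
  obtain ⟨h1, h2⟩ := leftContraction_mem_exteriorPower v p ha
  rw [rightContraction_eq]
  refine ⟨?_, fun hp => by rw [h2 hp, map_zero]⟩
  rw [gradeInvolution_of_mem h1]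
  exact Submodule.smul_mem _ _ h1

lemma ι_mul_mem_exteriorPower (θ : Dual ℝ V) {p : ℕ} {a : ExteriorAlgebra ℝ (Dual ℝ V)}
    (ha : a ∈ ⋀[ℝ]^p (Dual ℝ V)) :
    ExteriorAlgebra.ι ℝ θ * a ∈ ⋀[ℝ]^(p + 1) (Dual ℝ V) := by
  rw [ExteriorAlgebra.exteriorPower, pow_succ']
  exact Submodule.mul_mem_mul ⟨θ, rfl⟩ ha

variable [FiniteDimensional ℝ V]

lemma bivectorContraction_tmul (w : LinearMap.BilinForm ℝ (Dual ℝ V))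
    (a b : ExteriorAlgebra ℝ (Dual ℝ V)) :
    bivectorContraction w (a ⊗ₜ[ℝ] b) =
      ∑ i, ∑ j, w ((finBasis ℝ V).coord i) ((finBasis ℝ V).coord j) •
        (rightContraction (finBasis ℝ V i) a ⊗ₜ[ℝ] leftContraction (finBasis ℝ V j) b) := by
  simp only [bivectorContraction, LinearMap.sum_apply, LinearMap.smul_apply,
    TensorProduct.map_tmul]

/-- Each application of L_w lowers the degree of the first factor by one. -/
lemma bivectorContraction_pow_tmul_eq_zero (w : LinearMap.BilinForm ℝ (Dual ℝ V)) (p : ℕ)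
    {a : ExteriorAlgebra ℝ (Dual ℝ V)} (ha : a ∈ ⋀[ℝ]^p (Dual ℝ V))
    (b : ExteriorAlgebra ℝ (Dual ℝ V)) :
    (bivectorContraction w ^ (p + 1)) (a ⊗ₜ[ℝ] b) = 0 := by
  induction p generalizing a b with
  | zero =>
    rw [zero_add, pow_one, bivectorContraction_tmul]
    refine Finset.sum_eq_zero fun i _ => Finset.sum_eq_zero fun j _ => ?_
    rw [(rightContraction_mem_exteriorPower _ 0 ha).2 rfl, TensorProduct.zero_tmul, smul_zero]
  | succ p ih =>
    rw [pow_succ, Module.End.mul_apply, bivectorContraction_tmul]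
    simp only [map_sum, map_smul]
    refine Finset.sum_eq_zero fun i _ => Finset.sum_eq_zero fun j _ => ?_
    rw [ih (rightContraction_mem_exteriorPower _ (p + 1) ha).1, smul_zero]

lemma exterior_basis_mem (s : Finset (Fin (finrank ℝ V))) :
    (finBasis ℝ V).dualBasis.ExteriorAlgebra s ∈ ⋀[ℝ]^s.card (Dual ℝ V) := by
  rw [ExteriorAlgebra.basis_apply]
  exact ExteriorAlgebra.ιMulti_range ℝ _ ⟨_, rfl⟩

/-- A basis of Λ(V*) consists of elements of degree at most dim V. So the truncation in
`quantumWedge` loses nothing, and coefficients may be compared for every `k`. -/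
lemma bivectorContraction_pow_eq_zero (w : LinearMap.BilinForm ℝ (Dual ℝ V)) {k : ℕ}
    (hk : finrank ℝ V < k) : bivectorContraction w ^ k = 0 := by
  have h : ∀ a b, (bivectorContraction w ^ k) (a ⊗ₜ[ℝ] b) = 0 := by
    intro a b
    rw [← ((finBasis ℝ V).dualBasis.ExteriorAlgebra).sum_repr a, TensorProduct.sum_tmul, map_sum]
    refine Finset.sum_eq_zero fun s _ => ?_
    have hs : s.card ≤ finrank ℝ V := by simpa using s.card_le_univ
    obtain ⟨m, rfl⟩ := Nat.exists_eq_add_of_le (show s.card + 1 ≤ k by omega)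
    rw [← TensorProduct.smul_tmul', map_smul, add_comm, pow_add, Module.End.mul_apply,
      bivectorContraction_pow_tmul_eq_zero w _ (exterior_basis_mem s), map_zero, smul_zero]
  exact TensorProduct.ext' h

lemma quantumWedgeCoeff_eq_zero (w : LinearMap.BilinForm ℝ (Dual ℝ V)) {k : ℕ}
    (hk : finrank ℝ V < k) (a b : ExteriorAlgebra ℝ (Dual ℝ V)) :
    quantumWedgeCoeff w k a b = 0 := by
  rw [quantumWedgeCoeff, bivectorContraction_pow_eq_zero w hk, LinearMap.zero_apply, map_zero,
    smul_zero]

lemma quantumWedge_coeff (w : LinearMap.BilinForm ℝ (Dual ℝ V)) (k : ℕ)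
    (a b : ExteriorAlgebra ℝ (Dual ℝ V)) :
    (quantumWedge w a b).coeff k = quantumWedgeCoeff w k a b := by
  simp only [quantumWedge, finsetSum_coeff, coeff_monomial, Finset.sum_ite_eq', Finset.mem_range]
  split_ifs with h
  · rfl
  · rw [quantumWedgeCoeff_eq_zero w (by omega)]

/-! ### Insertion of a bivector -/

/-- The insertion `Λ_w = ½ ∑ᵢⱼ wⁱʲ e_j ⌟ e_i ⌟ ·` of a bivector into multi-covectors. -/
def bivectorInsertion (w : LinearMap.BilinForm ℝ (Dual ℝ V)) :
    ExteriorAlgebra ℝ (Dual ℝ V) →ₗ[ℝ] ExteriorAlgebra ℝ (Dual ℝ V) :=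
  (2⁻¹ : ℝ) • ∑ i, ∑ j, w ((finBasis ℝ V).coord i) ((finBasis ℝ V).coord j) •
    leftContraction (finBasis ℝ V j) ∘ₗ leftContraction (finBasis ℝ V i)

/-- Independence of the basis, by changing one index at a time. It permits computing in the frame of
a chart. -/
lemma bivectorInsertion_apply {ι : Type*} [Fintype ι] (w : LinearMap.BilinForm ℝ (Dual ℝ V))
    (b : Basis ι ℝ V) (a : ExteriorAlgebra ℝ (Dual ℝ V)) :
    bivectorInsertion w a = (2⁻¹ : ℝ) • ∑ i, ∑ j, w (b.coord i) (b.coord j) •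
      leftContraction (b j) (leftContraction (b i) a) := by
  have h1 (ψ : Dual ℝ V) (v : V) := sum_coord_basis (LinearMap.mk₂ ℝ
    (fun (φ : Dual ℝ V) (u : V) => w ψ φ • leftContraction u (leftContraction v a))
    (by intros; rw [map_add, add_smul]) (by intros; rw [map_smul, smul_assoc])
    (by intros; rw [leftContraction_add, LinearMap.add_apply, smul_add])
    (by intros; rw [leftContraction_smul, LinearMap.smul_apply, smul_comm])) (finBasis ℝ V) b
  have h2 (ψ : Dual ℝ V) (v : V) := sum_coord_basis (LinearMap.mk₂ ℝ
    (fun (φ : Dual ℝ V) (u : V) => w φ ψ • leftContraction v (leftContraction u a))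
    (by intros; rw [map_add, LinearMap.add_apply, add_smul])
    (by intros; rw [map_smul, LinearMap.smul_apply, smul_assoc])
    (by intros; rw [leftContraction_add, LinearMap.add_apply, map_add, smul_add])
    (by intros; rw [leftContraction_smul, LinearMap.smul_apply, map_smul, smul_comm]))
    (finBasis ℝ V) b
  simp only [LinearMap.mk₂_apply] at h1 h2
  simp only [bivectorInsertion, LinearMap.smul_apply, LinearMap.sum_apply, LinearMap.comp_apply]
  simp only [h1]
  rw [Finset.sum_comm]
  simp only [h2]
  rw [Finset.sum_comm]

/-- Contractions anticommute, and the insertion contains two of them, so the signs cancel. -/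
lemma bivectorInsertion_leftContraction (w : LinearMap.BilinForm ℝ (Dual ℝ V)) (v : V)
    (a : ExteriorAlgebra ℝ (Dual ℝ V)) :
    bivectorInsertion w (leftContraction v a) = leftContraction v (bivectorInsertion w a) := by
  simp only [bivectorInsertion_apply w (finBasis ℝ V), map_smul, map_sum]
  congr 1
  refine Finset.sum_congr rfl fun i _ => Finset.sum_congr rfl fun j _ => ?_
  rw [leftContraction_comm _ v, map_neg, leftContraction_comm _ v, neg_neg]

lemma bivectorInsertion_gradeInvolution (w : LinearMap.BilinForm ℝ (Dual ℝ V))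
    (a : ExteriorAlgebra ℝ (Dual ℝ V)) :
    bivectorInsertion w (gradeInvolution a) = gradeInvolution (bivectorInsertion w a) := by
  simp only [bivectorInsertion_apply w (finBasis ℝ V), map_smul, map_sum,
    leftContraction_gradeInvolution, map_neg, neg_neg]

lemma bivectorInsertion_mem (w : LinearMap.BilinForm ℝ (Dual ℝ V)) (p : ℕ)
    {a : ExteriorAlgebra ℝ (Dual ℝ V)} (ha : a ∈ ⋀[ℝ]^p (Dual ℝ V)) :
    bivectorInsertion w a ∈ ⋀[ℝ]^(p - 2) (Dual ℝ V) ∧ (p < 2 → bivectorInsertion w a = 0) := by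
  rw [bivectorInsertion_apply w (finBasis ℝ V)]
  constructor
  · refine Submodule.smul_mem _ _ (sum_mem fun i _ => sum_mem fun j _ => Submodule.smul_mem _ _ ?_)
    exact (leftContraction_mem_exteriorPower _ _ (leftContraction_mem_exteriorPower _ p ha).1).1
  · intro hp
    rw [Finset.sum_eq_zero, smul_zero]
    refine fun i _ => Finset.sum_eq_zero fun j _ => ?_
    rw [(leftContraction_mem_exteriorPower _ _ (leftContraction_mem_exteriorPower _ p ha).1).2
      (by omega), smul_zero]

lemma bivectorInsertion_ι (w : LinearMap.BilinForm ℝ (Dual ℝ V)) (θ : Dual ℝ V) :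
    bivectorInsertion w (ExteriorAlgebra.ι ℝ θ) = 0 := by
  refine (bivectorInsertion_mem w 1 ?_).2 one_lt_two
  rw [ExteriorAlgebra.exteriorPower, pow_one]
  exact ⟨θ, rfl⟩

/-- Two uses of the antiderivation rule give two pure and two mixed terms. Alternation of `w` makes
the mixed sums agree, so the factor ½ disappears and they form m ∘ L_w. -/
lemma bivectorInsertion_mul {w : LinearMap.BilinForm ℝ (Dual ℝ V)} (hw : w.IsAlt)
    (a b : ExteriorAlgebra ℝ (Dual ℝ V)) :
    bivectorInsertion w (a * b) = bivectorInsertion w a * b + a * bivectorInsertion w b +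
      LinearMap.mul' ℝ _ (bivectorContraction w (a ⊗ₜ[ℝ] b)) := by
  -- Renaming the indices costs a sign because `w` is skew; this identifies the two mixed sums.
  have hsum : ∑ i, ∑ j, w ((finBasis ℝ V).coord i) ((finBasis ℝ V).coord j) •
      (rightContraction (finBasis ℝ V j) a * leftContraction (finBasis ℝ V i) b) =
      -∑ i, ∑ j, w ((finBasis ℝ V).coord i) ((finBasis ℝ V).coord j) •
      (rightContraction (finBasis ℝ V i) a * leftContraction (finBasis ℝ V j) b) := by
    rw [Finset.sum_comm, ← Finset.sum_neg_distrib]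
    refine Finset.sum_congr rfl fun i _ => ?_
    rw [← Finset.sum_neg_distrib]
    refine Finset.sum_congr rfl fun j _ => ?_
    rw [← LinearMap.BilinForm.IsAlt.neg_eq hw, neg_smul]
  have h (i j) : leftContraction (finBasis ℝ V j) (leftContraction (finBasis ℝ V i) (a * b)) =
      leftContraction (finBasis ℝ V j) (leftContraction (finBasis ℝ V i) a) * b +
      a * leftContraction (finBasis ℝ V j) (leftContraction (finBasis ℝ V i) b) +
      rightContraction (finBasis ℝ V i) a * leftContraction (finBasis ℝ V j) b -
      rightContraction (finBasis ℝ V j) a * leftContraction (finBasis ℝ V i) b := by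
    rw [leftContraction_mul, map_add, leftContraction_mul, leftContraction_mul,
      leftContraction_gradeInvolution, gradeInvolution_gradeInvolution, rightContraction_eq,
      rightContraction_eq, neg_mul]
    abel
  rw [bivectorContraction_tmul]
  simp only [bivectorInsertion_apply w (finBasis ℝ V), h, smul_add, smul_sub,
    Finset.sum_add_distrib, Finset.sum_sub_distrib, hsum, map_sum, map_smul,
    LinearMap.mul'_apply, smul_mul_assoc, mul_smul_comm, Finset.sum_mul, Finset.mul_sum]
  module

/-- The insertion is even, so it commutes with contractions and with the involution. This and its
`lTensor` twin let Λ pass through powers of L_w in the recurrence. -/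
lemma bivectorContraction_rTensor (w : LinearMap.BilinForm ℝ (Dual ℝ V)) :
    Commute (bivectorContraction w) ((bivectorInsertion w).rTensor _) := by
  refine TensorProduct.ext' fun a b => ?_
  simp only [Module.End.mul_apply, LinearMap.rTensor_tmul, bivectorContraction_tmul, map_sum,
    map_smul, rightContraction_eq, bivectorInsertion_gradeInvolution,
    bivectorInsertion_leftContraction]

lemma bivectorContraction_lTensor (w : LinearMap.BilinForm ℝ (Dual ℝ V)) :
    Commute (bivectorContraction w) ((bivectorInsertion w).lTensor _) := by
  refine TensorProduct.ext' fun a b => ?_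
  simp only [Module.End.mul_apply, LinearMap.lTensor_tmul, bivectorContraction_tmul, map_sum,
    map_smul, bivectorInsertion_leftContraction]

/-- The coefficients of the quantum exterior product satisfy the recurrence which expresses that
the exponential of the insertion intertwines the two exterior products. -/
lemma succ_smul_quantumWedgeCoeff {w : LinearMap.BilinForm ℝ (Dual ℝ V)} (hw : w.IsAlt) (k : ℕ)
    (a b : ExteriorAlgebra ℝ (Dual ℝ V)) :
    ((k : ℝ) + 1) • quantumWedgeCoeff w (k + 1) a b =
      bivectorInsertion w (quantumWedgeCoeff w k a b) -
        quantumWedgeCoeff w k (bivectorInsertion w a) b -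
        quantumWedgeCoeff w k a (bivectorInsertion w b) := by
  have key (t) : LinearMap.mul' ℝ _ (bivectorContraction w t) =
      bivectorInsertion w (LinearMap.mul' ℝ _ t) -
        LinearMap.mul' ℝ _ ((bivectorInsertion w).rTensor _ t) -
        LinearMap.mul' ℝ _ ((bivectorInsertion w).lTensor _ t) := by
    induction t with
    | zero => simp
    | add t s ht hs => simp only [map_add, ht, hs]; abel
    | tmul a b =>
      simp only [LinearMap.mul'_apply, LinearMap.rTensor_tmul, LinearMap.lTensor_tmul,
        bivectorInsertion_mul hw]
      abel
  have h1 : (bivectorInsertion w).rTensor _ ((bivectorContraction w ^ k) (a ⊗ₜ[ℝ] b)) =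
      (bivectorContraction w ^ k) (bivectorInsertion w a ⊗ₜ[ℝ] b) := by
    rw [← LinearMap.rTensor_tmul, ← Module.End.mul_apply, ← Module.End.mul_apply,
      ((bivectorContraction_rTensor w).pow_left k).eq]
  have h2 : (bivectorInsertion w).lTensor _ ((bivectorContraction w ^ k) (a ⊗ₜ[ℝ] b)) =
      (bivectorContraction w ^ k) (a ⊗ₜ[ℝ] bivectorInsertion w b) := by
    rw [← LinearMap.lTensor_tmul, ← Module.End.mul_apply, ← Module.End.mul_apply,
      ((bivectorContraction_lTensor w).pow_left k).eq]
  have hk : ((k : ℝ) + 1) * (((k + 1).factorial : ℝ)⁻¹) = ((k.factorial : ℝ)⁻¹) := by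
    rw [Nat.factorial_succ]
    push_cast
    field_simp
  simp only [quantumWedgeCoeff, smul_smul, hk, pow_succ', Module.End.mul_apply, key, h1, h2,
    map_smul, smul_sub]

lemma quantumWedgeCoeff_zero (w : LinearMap.BilinForm ℝ (Dual ℝ V))
    (a b : ExteriorAlgebra ℝ (Dual ℝ V)) : quantumWedgeCoeff w 0 a b = a * b := by
  simp [quantumWedgeCoeff]

/-- The recurrence at `k = 0`, with Λθ = 0. The h-part of multiplication by a covector is thus the
commutator [Λ, θ ∧ ·], the source of δ = [Λ, d]. -/
lemma quantumWedgeCoeff_one_ι {w : LinearMap.BilinForm ℝ (Dual ℝ V)} (hw : w.IsAlt)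
    (θ : Dual ℝ V) (b : ExteriorAlgebra ℝ (Dual ℝ V)) :
    quantumWedgeCoeff w 1 (ExteriorAlgebra.ι ℝ θ) b =
      bivectorInsertion w (ExteriorAlgebra.ι ℝ θ * b) -
        ExteriorAlgebra.ι ℝ θ * bivectorInsertion w b := by
  have h := succ_smul_quantumWedgeCoeff hw 0 (ExteriorAlgebra.ι ℝ θ) b
  simpa [quantumWedgeCoeff_zero, bivectorInsertion_ι] using h

lemma quantumWedgeCoeff_ι_eq_zero (w : LinearMap.BilinForm ℝ (Dual ℝ V)) (k : ℕ)
    (θ : Dual ℝ V) (b : ExteriorAlgebra ℝ (Dual ℝ V)) :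
    quantumWedgeCoeff w (k + 2) (ExteriorAlgebra.ι ℝ θ) b = 0 := by
  have hθ : ExteriorAlgebra.ι ℝ θ ∈ ⋀[ℝ]^1 (Dual ℝ V) := by
    rw [ExteriorAlgebra.exteriorPower, pow_one]
    exact ⟨θ, rfl⟩
  rw [quantumWedgeCoeff, pow_add, Module.End.mul_apply,
    bivectorContraction_pow_tmul_eq_zero w 1 hθ, map_zero, map_zero, smul_zero]

/-- Exterior multiplication with a covector and insertion of a bivector have a commutator which
commutes with the insertion. -/
lemma bivectorInsertion_ι_mul {w : LinearMap.BilinForm ℝ (Dual ℝ V)} (hw : w.IsAlt)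
    (θ : Dual ℝ V) (b : ExteriorAlgebra ℝ (Dual ℝ V)) :
    bivectorInsertion w (bivectorInsertion w (ExteriorAlgebra.ι ℝ θ * b)) =
      (2 : ℝ) • bivectorInsertion w (ExteriorAlgebra.ι ℝ θ * bivectorInsertion w b) -
        ExteriorAlgebra.ι ℝ θ * bivectorInsertion w (bivectorInsertion w b) := by
  -- At `k = 1` the left side vanishes, since a covector is killed by two contractions; the right
  -- side is the double commutator [Λ, [Λ, θ ∧ ·]] applied to `b`.
  have h := succ_smul_quantumWedgeCoeff hw 1 (ExteriorAlgebra.ι ℝ θ) b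
  have h0 : quantumWedgeCoeff w 1 0 b = 0 := by simp [quantumWedgeCoeff]
  rw [quantumWedgeCoeff_ι_eq_zero, bivectorInsertion_ι, h0, quantumWedgeCoeff_one_ι hw,
    quantumWedgeCoeff_one_ι hw, map_sub, smul_zero] at h
  rw [two_smul, ← sub_eq_zero, h]
  abel

end Fiber

end

end QuantumDeRham

namespace QuantumDeRham

noncomputable section

/-! ### Coordinate derivatives of functions on the manifold. -/

section ScalarCalculus

variable {E : Type*} [NormedAddCommGroup E] [NormedSpace ℝ E]
  {M : Type*} [TopologicalSpace M] [ChartedSpace E M] [IsManifold 𝓘(ℝ, E) ∞ M]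

lemma mem_baseSet_iff {x₀ y : M} :
    y ∈ (trivializationAt E (TangentSpace 𝓘(ℝ, E) : M → Type _) x₀).baseSet ↔
      y ∈ (chartAt E x₀).source := by
  rw [TangentBundle.trivializationAt_baseSet]

/-- Coordinate derivatives are derivatives of the representation in the chart. -/
lemma mvfderiv_symmL_eq {f : M → ℝ} {x₀ y : M} (hy : y ∈ (chartAt E x₀).source)
    (hf : MDifferentiableAt 𝓘(ℝ, E) 𝓘(ℝ) f y) (v : E) :
    mvfderiv 𝓘(ℝ, E) f y
        ((trivializationAt E (TangentSpace 𝓘(ℝ, E) : M → Type _) x₀).symmL ℝ y v) =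
      fderiv ℝ (f ∘ (extChartAt 𝓘(ℝ, E) x₀).symm) (extChartAt 𝓘(ℝ, E) x₀ y) v := by
  rw [TangentBundle.symmL_trivializationAt hy]
  have hs : (extChartAt 𝓘(ℝ, E) x₀).symm (extChartAt 𝓘(ℝ, E) x₀ y) = y :=
    (extChartAt 𝓘(ℝ, E) x₀).left_inv (by rwa [extChartAt_source])
  have h1 : MDifferentiableWithinAt 𝓘(ℝ, E) 𝓘(ℝ, E) (extChartAt 𝓘(ℝ, E) x₀).symm
      (Set.range 𝓘(ℝ, E)) (extChartAt 𝓘(ℝ, E) x₀ y) :=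
    mdifferentiableWithinAt_extChartAt_symm
      ((extChartAt 𝓘(ℝ, E) x₀).map_source (by rwa [extChartAt_source]))
  rw [ModelWithCorners.range_eq_univ, mdifferentiableWithinAt_univ] at h1
  have h2 := mvfderiv_comp_apply_of_eq (g := f) (f := (extChartAt 𝓘(ℝ, E) x₀).symm)
    (extChartAt 𝓘(ℝ, E) x₀ y) hf h1 hs v
  rw [ModelWithCorners.range_eq_univ, mfderivWithin_univ]
  refine h2.symm.trans ?_
  rw [mvfderiv, mfderiv_eq_fderiv]
  rfl

lemma contDiffAt_comp_extChartAt_symm {f : M → ℝ} {x₀ y : M} (hy : y ∈ (chartAt E x₀).source)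
    (hf : ContMDiffAt 𝓘(ℝ, E) 𝓘(ℝ) ∞ f y) :
    ContDiffAt ℝ ∞ (f ∘ (extChartAt 𝓘(ℝ, E) x₀).symm) (extChartAt 𝓘(ℝ, E) x₀ y) := by
  have hy' : y ∈ (extChartAt 𝓘(ℝ, E) x₀).source := by rwa [extChartAt_source]
  have hs : (extChartAt 𝓘(ℝ, E) x₀).symm (extChartAt 𝓘(ℝ, E) x₀ y) = y :=
    (extChartAt 𝓘(ℝ, E) x₀).left_inv hy'
  have h1 : ContMDiffAt 𝓘(ℝ, E) 𝓘(ℝ, E) ∞ (extChartAt 𝓘(ℝ, E) x₀).symm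
      (extChartAt 𝓘(ℝ, E) x₀ y) :=
    (contMDiffOn_extChartAt_symm x₀).contMDiffAt (extChartAt_target_mem_nhds' ((extChartAt 𝓘(ℝ, E) x₀).map_source hy'))
  rw [← contMDiffAt_iff_contDiffAt]
  exact ContMDiffAt.comp _ (by rwa [hs]) h1

/-- A coordinate derivative of a smooth function, near a given point. -/
lemma eventually_mvfderiv_symmL_eq {f : M → ℝ} {x₀ y : M} (hy : y ∈ (chartAt E x₀).source)
    (hf : ContMDiffAt 𝓘(ℝ, E) 𝓘(ℝ) ∞ f y) (v : E) :
    ∀ᶠ z in nhds y, mvfderiv 𝓘(ℝ, E) f z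
        ((trivializationAt E (TangentSpace 𝓘(ℝ, E) : M → Type _) x₀).symmL ℝ z v) =
      fderiv ℝ (f ∘ (extChartAt 𝓘(ℝ, E) x₀).symm) (extChartAt 𝓘(ℝ, E) x₀ z) v := by
  have h1 : ContMDiffAt 𝓘(ℝ, E) 𝓘(ℝ) 1 f y := hf.of_le (by simp)
  filter_upwards [(contMDiffAt_iff_contMDiffAt_nhds (by simp)).1 h1, (chartAt E x₀).open_source.mem_nhds hy] with z hz hz'
  exact mvfderiv_symmL_eq hz' (hz.mdifferentiableAt one_ne_zero) v

lemma contMDiffAt_mvfderiv_symmL {f : M → ℝ} {x₀ y : M} (hy : y ∈ (chartAt E x₀).source)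
    (hf : ContMDiffAt 𝓘(ℝ, E) 𝓘(ℝ) ∞ f y) (v : E) :
    ContMDiffAt 𝓘(ℝ, E) 𝓘(ℝ) ∞ (fun z => mvfderiv 𝓘(ℝ, E) f z
        ((trivializationAt E (TangentSpace 𝓘(ℝ, E) : M → Type _) x₀).symmL ℝ z v)) y := by
  refine ContMDiffAt.congr_of_eventuallyEq ?_ (eventually_mvfderiv_symmL_eq hy hf v)
  have h2 : ContDiffAt ℝ ∞ (fun p => fderiv ℝ (f ∘ (extChartAt 𝓘(ℝ, E) x₀).symm) p v)
      (extChartAt 𝓘(ℝ, E) x₀ y) :=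
    ((contDiffAt_comp_extChartAt_symm hy hf).fderiv_right (by simp)).clm_apply contDiffAt_const
  exact h2.contMDiffAt.comp y (contMDiffAt_extChartAt' hy)

/-- Frame fields of a chart are coordinate fields, so this is the symmetry of the second derivative
of `f` read in the chart. It underlies d² = 0 and the chart independence of d. -/
lemma mvfderiv_symmL_comm {f : M → ℝ} {x₀ y : M} (hy : y ∈ (chartAt E x₀).source)
    (hf : ContMDiffAt 𝓘(ℝ, E) 𝓘(ℝ) ∞ f y) (u v : E) :
    mvfderiv 𝓘(ℝ, E) (fun z => mvfderiv 𝓘(ℝ, E) f z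
        ((trivializationAt E (TangentSpace 𝓘(ℝ, E) : M → Type _) x₀).symmL ℝ z v)) y
        ((trivializationAt E (TangentSpace 𝓘(ℝ, E) : M → Type _) x₀).symmL ℝ y u) =
      mvfderiv 𝓘(ℝ, E) (fun z => mvfderiv 𝓘(ℝ, E) f z
        ((trivializationAt E (TangentSpace 𝓘(ℝ, E) : M → Type _) x₀).symmL ℝ z u)) y
        ((trivializationAt E (TangentSpace 𝓘(ℝ, E) : M → Type _) x₀).symmL ℝ y v) := by
  have hF := contDiffAt_comp_extChartAt_symm hy hf
  have hy' : y ∈ (extChartAt 𝓘(ℝ, E) x₀).source := by rwa [extChartAt_source]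
  have hs : (extChartAt 𝓘(ℝ, E) x₀).symm (extChartAt 𝓘(ℝ, E) x₀ y) = y :=
    (extChartAt 𝓘(ℝ, E) x₀).left_inv hy'
  set F := f ∘ (extChartAt 𝓘(ℝ, E) x₀).symm with hFdef
  have key (u v : E) : mvfderiv 𝓘(ℝ, E) (fun z => mvfderiv 𝓘(ℝ, E) f z
        ((trivializationAt E (TangentSpace 𝓘(ℝ, E) : M → Type _) x₀).symmL ℝ z v)) y
        ((trivializationAt E (TangentSpace 𝓘(ℝ, E) : M → Type _) x₀).symmL ℝ y u) =
      fderiv ℝ (fderiv ℝ F) (extChartAt 𝓘(ℝ, E) x₀ y) u v := by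
    rw [mvfderiv_symmL_eq hy
      ((contMDiffAt_mvfderiv_symmL hy hf v).mdifferentiableAt (by simp))]
    have h1 : ((fun z => mvfderiv 𝓘(ℝ, E) f z
        ((trivializationAt E (TangentSpace 𝓘(ℝ, E) : M → Type _) x₀).symmL ℝ z v)) ∘
          (extChartAt 𝓘(ℝ, E) x₀).symm) =ᶠ[nhds (extChartAt 𝓘(ℝ, E) x₀ y)]
        fun p => fderiv ℝ F p v := by
      have hc : Filter.Tendsto (extChartAt 𝓘(ℝ, E) x₀).symm (nhds (extChartAt 𝓘(ℝ, E) x₀ y))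
          (nhds y) := by
        have := continuousAt_extChartAt_symm' hy'
        rwa [ContinuousAt, hs] at this
      filter_upwards [hc.eventually (eventually_mvfderiv_symmL_eq hy hf v),
        extChartAt_target_mem_nhds' ((extChartAt 𝓘(ℝ, E) x₀).map_source hy')] with p hp hp'
      rw [Function.comp_apply, hp, (extChartAt 𝓘(ℝ, E) x₀).right_inv hp']
    rw [h1.fderiv_eq]
    have h2 : DifferentiableAt ℝ (fderiv ℝ F) (extChartAt 𝓘(ℝ, E) x₀ y) :=
      (hF.fderiv_right (m := 1) (WithTop.coe_le_coe.2 le_top)).differentiableAt one_ne_zero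
    rw [fderiv_clm_apply h2 (differentiableAt_const v)]
    simp
  rw [key, key]
  exact (hF.isSymmSndFDerivAt
    (by rw [minSmoothness_of_isRCLikeNormedField]; exact ENat.LEInfty.out)).eq u v

end ScalarCalculus

end

end QuantumDeRham

namespace QuantumDeRham

noncomputable section

/-! ### Componentwise calculus for functions with values in Λ(E*). -/

section ModelCalculus

set_option linter.unusedSectionVars false

variable {E : Type*} [NormedAddCommGroup E] [NormedSpace ℝ E] [FiniteDimensional ℝ E]
  {M : Type*} [TopologicalSpace M] [ChartedSpace E M] [IsManifold 𝓘(ℝ, E) ∞ M]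

/-- The derivative of a function with values in `Λ(E*)`. -/
def modelDeriv (f : M → ExteriorAlgebra ℝ (Dual ℝ E)) (x : M) :
    TangentSpace 𝓘(ℝ, E) x →ₗ[ℝ] ExteriorAlgebra ℝ (Dual ℝ E) :=
  ∑ I, (mvfderiv 𝓘(ℝ, E) (fun y => (modelBasis E).repr (f y) I) x :
    TangentSpace 𝓘(ℝ, E) x →ₗ[ℝ] ℝ).smulRight (modelBasis E I)

variable {f g : M → ExteriorAlgebra ℝ (Dual ℝ E)} {x : M}

lemma modelDeriv_apply (f : M → ExteriorAlgebra ℝ (Dual ℝ E)) (v : TangentSpace 𝓘(ℝ, E) x) :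
    modelDeriv f x v =
      ∑ I, mvfderiv 𝓘(ℝ, E) (fun y => (modelBasis E).repr (f y) I) x v • modelBasis E I := by
  simp [modelDeriv, LinearMap.sum_apply]

lemma repr_modelDeriv (f : M → ExteriorAlgebra ℝ (Dual ℝ E)) (v : TangentSpace 𝓘(ℝ, E) x) (I) :
    (modelBasis E).repr (modelDeriv f x v) I =
      mvfderiv 𝓘(ℝ, E) (fun y => (modelBasis E).repr (f y) I) x v := by
  rw [modelDeriv_apply, Basis.repr_sum_self]

lemma WeakSmoothAt.repr (hf : WeakSmoothAt E f x) (I) :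
    ContMDiffAt 𝓘(ℝ, E) 𝓘(ℝ) ∞ (fun y => (modelBasis E).repr (f y) I) x :=
  hf ((modelBasis E).coord I)

lemma weakSmoothAt_of_repr
    (hf : ∀ I, ContMDiffAt 𝓘(ℝ, E) 𝓘(ℝ) ∞ (fun y => (modelBasis E).repr (f y) I) x) :
    WeakSmoothAt E f x := by
  have h : f = fun y => ∑ I, (modelBasis E).repr (f y) I • modelBasis E I := by
    funext y
    rw [(modelBasis E).sum_repr]
  rw [h]
  refine WeakSmoothAt.sum fun I _ => WeakSmoothAt.smul (f := fun _ => modelBasis E I) ?_ (hf I)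
  exact fun l => contMDiffAt_const

lemma weakSmoothAt_const {W : Type*} [AddCommGroup W] [Module ℝ W] (c : W) :
    WeakSmoothAt E (fun _ : M => c) x :=
  fun _ => contMDiffAt_const

lemma mvfderiv_congr {φ ψ : M → ℝ} (h : φ =ᶠ[nhds x] ψ) :
    mvfderiv 𝓘(ℝ, E) φ x = mvfderiv 𝓘(ℝ, E) ψ x := by
  have h1 := h.mfderiv_eq (I := 𝓘(ℝ, E)) (I' := 𝓘(ℝ))
  ext v
  exact congrArg (fun L : TangentSpace 𝓘(ℝ, E) x →L[ℝ] ℝ => L v) h1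

lemma modelDeriv_congr (h : ∀ᶠ y in nhds x, f y = g y) : modelDeriv f x = modelDeriv g x := by
  unfold modelDeriv
  refine Finset.sum_congr rfl fun I _ => ?_
  have h1 : (fun y => (modelBasis E).repr (f y) I) =ᶠ[nhds x]
      fun y => (modelBasis E).repr (g y) I := h.mono fun y hy => by simp only [hy]
  rw [mvfderiv_congr h1]

lemma modelDeriv_const (c : ExteriorAlgebra ℝ (Dual ℝ E)) :
    modelDeriv (fun _ : M => c) x = 0 := by
  ext v
  rw [modelDeriv_apply]
  simp [mvfderiv_const]

lemma modelDeriv_add (hf : WeakSmoothAt E f x) (hg : WeakSmoothAt E g x) :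
    modelDeriv (fun y => f y + g y) x = modelDeriv f x + modelDeriv g x := by
  ext v
  simp only [modelDeriv_apply, map_add, Finsupp.add_apply, LinearMap.add_apply]
  rw [← Finset.sum_add_distrib]
  refine Finset.sum_congr rfl fun I _ => ?_
  rw [mvfderiv_fun_add ((hf.repr I).mdifferentiableAt (by simp))
    ((hg.repr I).mdifferentiableAt (by simp)), add_apply, add_smul]

lemma modelDeriv_smul {c : M → ℝ} (hc : ContMDiffAt 𝓘(ℝ, E) 𝓘(ℝ) ∞ c x)
    (hf : WeakSmoothAt E f x) (v : TangentSpace 𝓘(ℝ, E) x) :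
    modelDeriv (fun y => c y • f y) x v =
      mvfderiv 𝓘(ℝ, E) c x v • f x + c x • modelDeriv f x v := by
  refine (modelBasis E).ext_elem fun I => ?_
  simp only [repr_modelDeriv, map_add, map_smul, Finsupp.add_apply, Finsupp.smul_apply,
    smul_eq_mul]
  rw [mvfderiv_fun_mul (hc.mdifferentiableAt (by simp)) ((hf.repr I).mdifferentiableAt (by simp)),
    add_apply, smul_apply, smul_apply,
    smul_eq_mul, smul_eq_mul]
  ring

lemma modelDeriv_sum {ι : Type*} {s : Finset ι} {F : ι → M → ExteriorAlgebra ℝ (Dual ℝ E)}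
    (hF : ∀ i ∈ s, WeakSmoothAt E (F i) x) :
    modelDeriv (fun y => ∑ i ∈ s, F i y) x = ∑ i ∈ s, modelDeriv (F i) x := by
  classical
  induction s using Finset.induction_on with
  | empty => simp only [Finset.sum_empty]; exact modelDeriv_const 0
  | insert a s ha ih =>
    simp only [Finset.sum_insert ha]
    rw [modelDeriv_add (hF a (by simp)) (WeakSmoothAt.sum fun i hi => hF i (by simp [hi])),
      ih fun i hi => hF i (by simp [hi])]

lemma modelDeriv_map (hf : WeakSmoothAt E f x)
    (A : ExteriorAlgebra ℝ (Dual ℝ E) →ₗ[ℝ] ExteriorAlgebra ℝ (Dual ℝ E))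
    (v : TangentSpace 𝓘(ℝ, E) x) :
    modelDeriv (fun y => A (f y)) x v = A (modelDeriv f x v) := by
  have h : (fun y => A (f y)) =
      fun y => ∑ I, (modelBasis E).repr (f y) I • A (modelBasis E I) := by
    funext y
    conv_lhs => rw [← (modelBasis E).sum_repr (f y), map_sum]
    simp only [map_smul]
  rw [h, modelDeriv_sum fun I _ => (weakSmoothAt_const _).smul (hf.repr I), LinearMap.sum_apply,
    modelDeriv_apply, map_sum]
  refine Finset.sum_congr rfl fun I _ => ?_
  rw [modelDeriv_smul (hf.repr I) (weakSmoothAt_const _), modelDeriv_const, map_smul]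
  simp

lemma WeakSmoothAt.mul (hf : WeakSmoothAt E f x) (hg : WeakSmoothAt E g x) :
    WeakSmoothAt E (fun y => f y * g y) x :=
  ((hf.tmul (modelBasis E) hg).map (LinearMap.mul' ℝ _)).congr (by simp)

lemma modelDeriv_mul (hf : WeakSmoothAt E f x) (hg : WeakSmoothAt E g x)
    (v : TangentSpace 𝓘(ℝ, E) x) :
    modelDeriv (fun y => f y * g y) x v = modelDeriv f x v * g x + f x * modelDeriv g x v := by
  have h : (fun y => f y * g y) = fun y => ∑ I, (modelBasis E).repr (f y) I •
      LinearMap.mulLeft ℝ (modelBasis E I) (g y) := by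
    funext y
    conv_lhs => rw [← (modelBasis E).sum_repr (f y), Finset.sum_mul]
    simp only [smul_mul_assoc, LinearMap.mulLeft_apply]
  rw [h, modelDeriv_sum fun I _ => (hg.map _).smul (hf.repr I), LinearMap.sum_apply]
  have h1 (I) : modelDeriv (fun y => (modelBasis E).repr (f y) I •
      LinearMap.mulLeft ℝ (modelBasis E I) (g y)) x v =
      mvfderiv 𝓘(ℝ, E) (fun y => (modelBasis E).repr (f y) I) x v • (modelBasis E I * g x) +
        (modelBasis E).repr (f x) I • (modelBasis E I * modelDeriv g x v) := by
    rw [modelDeriv_smul (hf.repr I) (hg.map _), modelDeriv_map hg]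
    rfl
  simp only [h1, Finset.sum_add_distrib]
  congr 1
  · rw [modelDeriv_apply, Finset.sum_mul]
    simp only [smul_mul_assoc]
  · conv_rhs => rw [← (modelBasis E).sum_repr (f x), Finset.sum_mul]
    simp only [smul_mul_assoc]

/-- The projection along `S` onto a complement kills `f`, hence also its derivative. With `S` an
exterior power, differentiation preserves the degree. -/
lemma modelDeriv_mem (S : Submodule ℝ (ExteriorAlgebra ℝ (Dual ℝ E))) (hf : WeakSmoothAt E f x)
    (h : ∀ y, f y ∈ S) (v : TangentSpace 𝓘(ℝ, E) x) : modelDeriv f x v ∈ S := by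
  obtain ⟨T, hT⟩ := S.exists_isCompl
  have h1 : (fun y => T.projection S hT.symm (f y)) = fun _ => 0 := by
    funext y
    exact (Submodule.projection_apply_eq_zero_iff hT.symm).2 (h y)
  have h2 := modelDeriv_map hf (T.projection S hT.symm) v
  rw [h1, modelDeriv_const, LinearMap.zero_apply] at h2
  exact (Submodule.projection_apply_eq_zero_iff hT.symm).1 h2.symm

/-! ### The exterior derivative in a chart -/

lemma frame_eq (x₀ y : M) (j) : frame E x₀ j y =
    (trivializationAt E (TangentSpace 𝓘(ℝ, E) : M → Type _) x₀).symmL ℝ y (finBasis ℝ E j) := rfl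

/-- The member `b^i` of the coframe of the model space, as an element of `Λ(E*)`. -/
abbrev modelCovector (E : Type*) [NormedAddCommGroup E] [NormedSpace ℝ E]
    [FiniteDimensional ℝ E] (i : Fin (finrank ℝ E)) : ExteriorAlgebra ℝ (Dual ℝ E) :=
  ExteriorAlgebra.ι ℝ ((finBasis ℝ E).coord i)

/-- The exterior derivative `∑ᵢ b^i ∧ ∂ᵢ f` in the chart at `x₀`. -/
def chartD (x₀ : M) (f : M → ExteriorAlgebra ℝ (Dual ℝ E)) (y : M) :
    ExteriorAlgebra ℝ (Dual ℝ E) :=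
  ∑ i, modelCovector E i * modelDeriv f y (frame E x₀ i y)

/-- The source of the sign in the Leibniz rule for d: the covectors b^i have to be moved past the
first factor. -/
lemma ι_mul_eq {V : Type*} [AddCommGroup V] [Module ℝ V] (θ : Dual ℝ V)
    (a : ExteriorAlgebra ℝ (Dual ℝ V)) :
    ExteriorAlgebra.ι ℝ θ * a = gradeInvolution a * ExteriorAlgebra.ι ℝ θ := by
  induction a using exterior_induction with
  | scalar r => rw [AlgHom.commutes, Algebra.commutes]
  | add x y hx hy => rw [mul_add, map_add, add_mul, hx, hy]
  | ι_mul η x hx =>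
    rw [map_mul, mul_assoc, ← hx, gradeInvolution_ι, ← mul_assoc, ← mul_assoc,
      eq_neg_of_add_eq_zero_left (ExteriorAlgebra.ι_add_mul_swap θ η), neg_mul, neg_mul, neg_mul]

variable {x₀ y : M}

lemma chartD_congr (h : ∀ᶠ z in nhds y, f z = g z) : chartD x₀ f y = chartD x₀ g y := by
  simp only [chartD, modelDeriv_congr h]

lemma chartD_const (c : ExteriorAlgebra ℝ (Dual ℝ E)) : chartD x₀ (fun _ => c) y = 0 := by
  simp [chartD, modelDeriv_const]

lemma chartD_add (hf : WeakSmoothAt E f y) (hg : WeakSmoothAt E g y) :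
    chartD x₀ (fun z => f z + g z) y = chartD x₀ f y + chartD x₀ g y := by
  simp only [chartD, modelDeriv_add hf hg, LinearMap.add_apply, mul_add, Finset.sum_add_distrib]

lemma chartD_mul (hf : WeakSmoothAt E f y) (hg : WeakSmoothAt E g y) :
    chartD x₀ (fun z => f z * g z) y =
      chartD x₀ f y * g y + gradeInvolution (f y) * chartD x₀ g y := by
  simp only [chartD, modelDeriv_mul hf hg, Finset.sum_mul, Finset.mul_sum, mul_add,
    ← Finset.sum_add_distrib]
  refine Finset.sum_congr rfl fun i _ => ?_
  rw [← mul_assoc, ← mul_assoc, ← mul_assoc, ι_mul_eq _ (f y)]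

lemma chartD_sum_smul {ι : Type*} {s : Finset ι} {c : ι → M → ℝ}
    {F : ι → M → ExteriorAlgebra ℝ (Dual ℝ E)}
    (hc : ∀ i ∈ s, ContMDiffAt 𝓘(ℝ, E) 𝓘(ℝ) ∞ (c i) y) (hF : ∀ i ∈ s, WeakSmoothAt E (F i) y) :
    chartD x₀ (fun z => ∑ i ∈ s, c i z • F i z) y =
      ∑ i ∈ s, ((∑ j, mvfderiv 𝓘(ℝ, E) (c i) y (frame E x₀ j y) • modelCovector E j) * F i y +
        c i y • chartD x₀ (F i) y) := by
  simp only [chartD]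
  rw [modelDeriv_sum fun i hi => (hF i hi).smul (hc i hi)]
  simp only [LinearMap.sum_apply, Finset.mul_sum]
  rw [Finset.sum_comm]
  refine Finset.sum_congr rfl fun i hi => ?_
  simp only [modelDeriv_smul (hc i hi) (hF i hi), mul_add, Finset.sum_add_distrib, Finset.sum_mul,
    Finset.smul_sum, mul_smul_comm, smul_mul_assoc]

lemma WeakSmoothAt.modelDeriv_frame (hy : y ∈ (chartAt E x₀).source) (hf : WeakSmoothAt E f y)
    (i) : WeakSmoothAt E (fun z => modelDeriv f z (frame E x₀ i z)) y := by
  refine weakSmoothAt_of_repr fun I => ?_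
  simp only [repr_modelDeriv]
  exact contMDiffAt_mvfderiv_symmL hy (hf.repr I) _

lemma modelDeriv_frame_comm (hy : y ∈ (chartAt E x₀).source) (hf : WeakSmoothAt E f y) (i j) :
    modelDeriv (fun z => modelDeriv f z (frame E x₀ i z)) y (frame E x₀ j y) =
      modelDeriv (fun z => modelDeriv f z (frame E x₀ j z)) y (frame E x₀ i y) := by
  refine (modelBasis E).ext_elem fun I => ?_
  simp only [repr_modelDeriv]
  exact mvfderiv_symmL_comm hy (hf.repr I) _ _

lemma WeakSmoothAt.chartD (hy : y ∈ (chartAt E x₀).source) (hf : WeakSmoothAt E f y) :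
    WeakSmoothAt E (chartD x₀ f) y :=
  WeakSmoothAt.sum fun i _ => (hf.modelDeriv_frame hy i).map (LinearMap.mulLeft ℝ _)

/-- A skew expression is paired with a symmetric one, so the sum equals its negative. The symmetric
factor will be a second derivative (d² = 0, closedness of differentials) or the Christoffel symbols
of a torsion-free connection. -/
lemma sum_ι_mul_ι_eq_zero {V : Type*} [AddCommGroup V] [Module ℝ V] {ι : Type*} [Fintype ι]
    (θ : ι → Dual ℝ V) (B : ι → ι → ExteriorAlgebra ℝ (Dual ℝ V)) (hB : ∀ i j, B i j = B j i) :
    ∑ i, ∑ j, ExteriorAlgebra.ι ℝ (θ i) * (ExteriorAlgebra.ι ℝ (θ j) * B i j) = 0 := by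
  have h : ∑ i, ∑ j, ExteriorAlgebra.ι ℝ (θ i) * (ExteriorAlgebra.ι ℝ (θ j) * B i j) =
      -∑ i, ∑ j, ExteriorAlgebra.ι ℝ (θ i) * (ExteriorAlgebra.ι ℝ (θ j) * B i j) := by
    conv_lhs => rw [Finset.sum_comm]
    simp only [← Finset.sum_neg_distrib]
    refine Finset.sum_congr rfl fun i _ => Finset.sum_congr rfl fun j _ => ?_
    rw [← mul_assoc, ← mul_assoc,
      eq_neg_of_add_eq_zero_left (ExteriorAlgebra.ι_add_mul_swap (θ j) (θ i)), neg_mul, hB]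
  have h2 : (2 : ℝ) • ∑ i, ∑ j, ExteriorAlgebra.ι ℝ (θ i) *
      (ExteriorAlgebra.ι ℝ (θ j) * B i j) = 0 := by
    rw [two_smul]
    conv_lhs => lhs; rw [h]
    exact neg_add_cancel _
  exact (smul_eq_zero.1 h2).resolve_left two_ne_zero

lemma chartD_chartD (hy : y ∈ (chartAt E x₀).source) (hf : WeakSmoothAt E f y) :
    chartD x₀ (chartD x₀ f) y = 0 := by
  have h (j) : modelDeriv (chartD x₀ f) y (frame E x₀ j y) =
      ∑ i, modelCovector E i *
        modelDeriv (fun z => modelDeriv f z (frame E x₀ i z)) y (frame E x₀ j y) := by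
    rw [show chartD x₀ f = fun z => ∑ i, LinearMap.mulLeft ℝ (modelCovector E i)
      (modelDeriv f z (frame E x₀ i z)) from rfl,
      modelDeriv_sum fun i _ => (hf.modelDeriv_frame hy i).map _, LinearMap.sum_apply]
    exact Finset.sum_congr rfl fun i _ => modelDeriv_map (hf.modelDeriv_frame hy i) _ _
  rw [chartD]
  simp only [h, Finset.mul_sum]
  exact sum_ι_mul_ι_eq_zero _ _ fun i j => modelDeriv_frame_comm hy hf j i

/-- The differential of a function is closed. -/
lemma chartD_differential {φ : M → ℝ} (hy : y ∈ (chartAt E x₀).source)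
    (hφ : ContMDiffAt 𝓘(ℝ, E) 𝓘(ℝ) ∞ φ y) :
    chartD x₀ (fun z => ∑ j, mvfderiv 𝓘(ℝ, E) φ z (frame E x₀ j z) • modelCovector E j) y = 0 := by
  rw [chartD_sum_smul (c := fun j z => mvfderiv 𝓘(ℝ, E) φ z (frame E x₀ j z)) (fun j _ => contMDiffAt_mvfderiv_symmL hy hφ _)
    fun j _ => weakSmoothAt_const _]
  simp only [chartD_const, smul_zero, add_zero, Finset.sum_mul]
  rw [Finset.sum_comm]
  have h := sum_ι_mul_ι_eq_zero (fun j => (finBasis ℝ E).coord j) (fun i j =>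
    algebraMap ℝ _ (mvfderiv 𝓘(ℝ, E) (fun z => mvfderiv 𝓘(ℝ, E) φ z (frame E x₀ j z)) y
      (frame E x₀ i y))) fun i j =>
      congrArg _ (mvfderiv_symmL_comm hy hφ _ _)
  rw [← h]
  refine Finset.sum_congr rfl fun i _ => Finset.sum_congr rfl fun j _ => ?_
  rw [← Algebra.commutes, ← Algebra.smul_def, mul_smul_comm, smul_mul_assoc]

end ModelCalculus

end

end QuantumDeRham

namespace QuantumDeRham

noncomputable section

/-! ### The exterior derivative of differential forms and its independence of the chart. -/

section ExteriorDerivative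

set_option linter.unusedSectionVars false

variable {E : Type*} [NormedAddCommGroup E] [NormedSpace ℝ E] [FiniteDimensional ℝ E]
  {M : Type*} [TopologicalSpace M] [ChartedSpace E M] [IsManifold 𝓘(ℝ, E) ∞ M]
  {x₀ x₁ x y : M}

lemma continuousLinearMapAt_symmL (hy : y ∈ (chartAt E x₀).source) (v : E) :
    (trivializationAt E (TangentSpace 𝓘(ℝ, E) : M → Type _) x₀).continuousLinearMapAt ℝ y
      ((trivializationAt E (TangentSpace 𝓘(ℝ, E) : M → Type _) x₀).symmL ℝ y v) = v :=
  Trivialization.continuousLinearMapAt_symmL _ (mem_baseSet_iff.2 hy) v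

lemma symmL_continuousLinearMapAt (hy : y ∈ (chartAt E x₀).source) (v : TangentSpace 𝓘(ℝ, E) y) :
    (trivializationAt E (TangentSpace 𝓘(ℝ, E) : M → Type _) x₀).symmL ℝ y
      ((trivializationAt E (TangentSpace 𝓘(ℝ, E) : M → Type _) x₀).continuousLinearMapAt ℝ y v) =
        v :=
  Trivialization.symmL_continuousLinearMapAt _ (mem_baseSet_iff.2 hy) v

lemma ofModel_ι (θ : Dual ℝ E) : ofModel E x₀ y (ExteriorAlgebra.ι ℝ θ) =
    ExteriorAlgebra.ι ℝ (θ ∘ₗ ((trivializationAt E (TangentSpace 𝓘(ℝ, E) : M → Type _)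
      x₀).continuousLinearMapAt ℝ y : TangentSpace 𝓘(ℝ, E) y →ₗ[ℝ] E)) :=
  ExteriorAlgebra.map_apply_ι _ _

lemma toModel_ι (θ : Dual ℝ (TangentSpace 𝓘(ℝ, E) y)) :
    toModel E x₀ y (ExteriorAlgebra.ι ℝ θ) =
      ExteriorAlgebra.ι ℝ (θ ∘ₗ ((trivializationAt E (TangentSpace 𝓘(ℝ, E) : M → Type _)
        x₀).symmL ℝ y : E →ₗ[ℝ] TangentSpace 𝓘(ℝ, E) y)) :=
  ExteriorAlgebra.map_apply_ι _ _

lemma toModel_ofModel (hy : y ∈ (chartAt E x₀).source) (b : ExteriorAlgebra ℝ (Dual ℝ E)) :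
    toModel E x₀ y (ofModel E x₀ y b) = b := by
  induction b using exterior_induction with
  | scalar r => simp only [AlgHom.commutes]
  | add a b ha hb => simp only [map_add, ha, hb]
  | ι_mul θ b hb =>
    rw [map_mul, map_mul, hb, ofModel_ι, toModel_ι]
    congr 2
    ext v
    exact congrArg θ (continuousLinearMapAt_symmL hy v)

lemma ofModel_toModel (hy : y ∈ (chartAt E x₀).source) (a : CotangentAlgebra E y) :
    ofModel E x₀ y (toModel E x₀ y a) = a := by
  induction a using exterior_induction with
  | scalar r => simp only [AlgHom.commutes]
  | add a b ha hb => simp only [map_add, ha, hb]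
  | ι_mul θ b hb =>
    rw [map_mul, map_mul, hb, toModel_ι, ofModel_ι]
    congr 2
    ext v
    exact congrArg θ (symmL_continuousLinearMapAt hy v)

lemma ofModel_modelCovector (i) :
    ofModel E x₀ y (modelCovector E i) = ExteriorAlgebra.ι ℝ (coframe E x₀ i y) :=
  ofModel_ι _

lemma gradeInvolution_map {U V : Type*} [AddCommGroup V] [Module ℝ V] [AddCommGroup U]
    [Module ℝ U] (A : Dual ℝ V →ₗ[ℝ] Dual ℝ U) (a : ExteriorAlgebra ℝ (Dual ℝ V)) :
    gradeInvolution (ExteriorAlgebra.map A a) = ExteriorAlgebra.map A (gradeInvolution a) := by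
  induction a using exterior_induction with
  | scalar r => simp only [AlgHom.commutes]
  | add a b ha hb => simp only [map_add, ha, hb]
  | ι_mul θ b hb =>
    simp only [map_mul, hb, ExteriorAlgebra.map_apply_ι, gradeInvolution_ι, map_neg]

lemma map_mem_exteriorPower {U V : Type*} [AddCommGroup V] [Module ℝ V] [AddCommGroup U]
    [Module ℝ U] (A : Dual ℝ V →ₗ[ℝ] Dual ℝ U) {p : ℕ} {a : ExteriorAlgebra ℝ (Dual ℝ V)}
    (ha : a ∈ ⋀[ℝ]^p (Dual ℝ V)) : ExteriorAlgebra.map A a ∈ ⋀[ℝ]^p (Dual ℝ U) := by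
  have h : (⋀[ℝ]^p (Dual ℝ V)).map (ExteriorAlgebra.map A).toLinearMap ≤ ⋀[ℝ]^p (Dual ℝ U) := by
    rw [ExteriorAlgebra.exteriorPower, ExteriorAlgebra.exteriorPower, Submodule.map_pow]
    refine pow_le_pow_left' ?_ p
    rintro _ ⟨_, ⟨θ, rfl⟩, rfl⟩
    exact ⟨A θ, (ExteriorAlgebra.map_apply_ι _ _).symm⟩
  exact h ⟨a, ha, rfl⟩

/-! ### Change of charts -/

variable (E) in
/-- The map `Λ(E*) → Λ(E*)` induced by the transition from the chart at `x₀` to that at `x₁`. -/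
def transition (x₀ x₁ y : M) : ExteriorAlgebra ℝ (Dual ℝ E) →ₐ[ℝ] ExteriorAlgebra ℝ (Dual ℝ E) :=
  (toModel E x₁ y).comp (ofModel E x₀ y)

/-- A constant covector of the chart at `x₀` is the differential of the function θ ∘ chart; seen
from another chart it is no longer constant but remains exact. -/
lemma transition_ι (hy : y ∈ (chartAt E x₀).source) (θ : Dual ℝ E) :
    transition E x₀ x₁ y (ExteriorAlgebra.ι ℝ θ) =
      ∑ j, mvfderiv 𝓘(ℝ, E) (fun z => θ (extChartAt 𝓘(ℝ, E) x₀ z)) y (frame E x₁ j y) •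
        modelCovector E j := by
  have h1 : MDifferentiableAt 𝓘(ℝ, E) 𝓘(ℝ, E) (extChartAt 𝓘(ℝ, E) x₀) y :=
    mdifferentiableAt_extChartAt hy
  have h2 : MDifferentiableAt 𝓘(ℝ, E) 𝓘(ℝ) θ (extChartAt 𝓘(ℝ, E) x₀ y) :=
    (LinearMap.toContinuousLinearMap θ).differentiableAt.mdifferentiableAt
  have h3 (v : TangentSpace 𝓘(ℝ, E) y) :
      mvfderiv 𝓘(ℝ, E) (fun z => θ (extChartAt 𝓘(ℝ, E) x₀ z)) y v =
        θ ((trivializationAt E (TangentSpace 𝓘(ℝ, E) : M → Type _) x₀).continuousLinearMapAt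
          ℝ y v) := by
    rw [TangentBundle.continuousLinearMapAt_trivializationAt hy]
    refine (mvfderiv_comp_apply (g := θ) y h2 h1 v).trans ?_
    rw [mvfderiv, mfderiv_eq_fderiv]
    exact congrArg (fun L : E →L[ℝ] ℝ => L (mfderiv 𝓘(ℝ, E) 𝓘(ℝ, E) (extChartAt 𝓘(ℝ, E) x₀) y v))
      (LinearMap.toContinuousLinearMap θ).fderiv
  rw [transition, AlgHom.comp_apply, ofModel_ι, toModel_ι]
  simp only [h3, modelCovector, ← map_smul, ← map_sum]
  congr 1
  refine (Basis.sum_dual_apply_smul_coord (finBasis ℝ E) _).symm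

lemma contMDiffAt_linear_extChartAt (hy : y ∈ (chartAt E x₀).source) (θ : Dual ℝ E) :
    ContMDiffAt 𝓘(ℝ, E) 𝓘(ℝ) ∞ (fun z => θ (extChartAt 𝓘(ℝ, E) x₀ z)) y :=
  (LinearMap.toContinuousLinearMap θ).contDiff.contMDiff.contMDiffAt.comp y
    (contMDiffAt_extChartAt' hy)

/-- Constant forms are generated by covectors, whose images are differentials and hence closed, and
products of closed forms are closed. Smoothness is carried along in the induction because the
Leibniz rule requires it. -/
lemma weakSmoothAt_transition_and_chartD (hy : y ∈ (chartAt E x₀).source)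
    (hy' : y ∈ (chartAt E x₁).source) (b : ExteriorAlgebra ℝ (Dual ℝ E)) :
    WeakSmoothAt E (fun z => transition E x₀ x₁ z b) y ∧
      chartD x₁ (fun z => transition E x₀ x₁ z b) y = 0 := by
  induction b using exterior_induction with
  | scalar r =>
    simp only [AlgHom.commutes]
    exact ⟨weakSmoothAt_const _, chartD_const _⟩
  | add a b ha hb =>
    simp only [map_add]
    refine ⟨fun l => ?_, by rw [chartD_add ha.1 hb.1, ha.2, hb.2, add_zero]⟩
    simp only [map_add]
    exact (ha.1 l).add (hb.1 l)
  | ι_mul θ b hb =>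
    have h1 : ∀ᶠ z in nhds y, transition E x₀ x₁ z (ExteriorAlgebra.ι ℝ θ) =
        ∑ j, mvfderiv 𝓘(ℝ, E) (fun z => θ (extChartAt 𝓘(ℝ, E) x₀ z)) z (frame E x₁ j z) •
          modelCovector E j := by
      filter_upwards [(chartAt E x₀).open_source.mem_nhds hy] with z hz
      exact transition_ι hz θ
    have h2 : WeakSmoothAt E (fun z => transition E x₀ x₁ z (ExteriorAlgebra.ι ℝ θ)) y :=
      WeakSmoothAt.congr (WeakSmoothAt.sum fun j _ => (weakSmoothAt_const _).smul
        (contMDiffAt_mvfderiv_symmL hy' (contMDiffAt_linear_extChartAt hy θ) _)) h1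
    have h3 : chartD x₁ (fun z => transition E x₀ x₁ z (ExteriorAlgebra.ι ℝ θ)) y = 0 :=
      (chartD_congr h1).trans (chartD_differential hy' (contMDiffAt_linear_extChartAt hy θ))
    simp only [map_mul]
    exact ⟨h2.mul hb.1, by rw [chartD_mul h2 hb.1, h3, hb.2, zero_mul, mul_zero, add_zero]⟩

lemma WeakSmoothAt.transition (hy : y ∈ (chartAt E x₀).source) (hy' : y ∈ (chartAt E x₁).source)
    {f : M → ExteriorAlgebra ℝ (Dual ℝ E)} (hf : WeakSmoothAt E f y) :
    WeakSmoothAt E (fun z => transition E x₀ x₁ z (f z)) y := by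
  have h : (fun z => QuantumDeRham.transition E x₀ x₁ z (f z)) = fun z =>
      ∑ I, (modelBasis E).repr (f z) I • QuantumDeRham.transition E x₀ x₁ z (modelBasis E I) := by
    funext z
    conv_lhs => rw [← (modelBasis E).sum_repr (f z), map_sum]
    simp only [map_smul]
  rw [h]
  exact WeakSmoothAt.sum fun I _ =>
    (weakSmoothAt_transition_and_chartD hy hy' _).1.smul (hf.repr I)

/-- Both sums are the expansion of the covector `L` in a chart frame. It is applied to the
differentials of the components of a form. -/
lemma sum_apply_frame_smul_eq (hy : y ∈ (chartAt E x₀).source)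
    (L : TangentSpace 𝓘(ℝ, E) y →ₗ[ℝ] ℝ) :
    ∑ j, L (frame E x₁ j y) • modelCovector E j =
      transition E x₀ x₁ y (∑ j, L (frame E x₀ j y) • modelCovector E j) := by
  simp only [modelCovector, ← map_smul, ← map_sum]
  rw [transition, AlgHom.comp_apply, ofModel_ι, toModel_ι]
  congr 1
  have h (x₂ : M) : ∑ j, L (frame E x₂ j y) • (finBasis ℝ E).coord j =
      L ∘ₗ ((trivializationAt E (TangentSpace 𝓘(ℝ, E) : M → Type _) x₂).symmL ℝ y :
        E →ₗ[ℝ] TangentSpace 𝓘(ℝ, E) y) :=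
    Basis.sum_dual_apply_smul_coord (finBasis ℝ E) (L ∘ₗ ((trivializationAt E
      (TangentSpace 𝓘(ℝ, E) : M → Type _) x₂).symmL ℝ y : E →ₗ[ℝ] TangentSpace 𝓘(ℝ, E) y))
  rw [h, h]
  ext v
  exact congrArg L (symmL_continuousLinearMapAt hy _).symm

/-- The exterior derivative is compatible with changes of charts. -/
lemma chartD_transition (hy : y ∈ (chartAt E x₀).source) (hy' : y ∈ (chartAt E x₁).source)
    {f : M → ExteriorAlgebra ℝ (Dual ℝ E)} (hf : WeakSmoothAt E f y) :
    chartD x₁ (fun z => transition E x₀ x₁ z (f z)) y = transition E x₀ x₁ y (chartD x₀ f y) := by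
  have h : (fun z => QuantumDeRham.transition E x₀ x₁ z (f z)) = fun z =>
      ∑ I, (modelBasis E).repr (f z) I • QuantumDeRham.transition E x₀ x₁ z (modelBasis E I) := by
    funext z
    conv_lhs => rw [← (modelBasis E).sum_repr (f z), map_sum]
    simp only [map_smul]
  have h' : f = fun z => ∑ I, (modelBasis E).repr (f z) I • modelBasis E I := by
    funext z
    rw [(modelBasis E).sum_repr]
  -- Expand `f` in constant basis forms. On both sides only the differentials of the coefficients
  -- survive, because the basis forms and their images under the transition are closed.
  rw [h, chartD_sum_smul (fun I _ => hf.repr I)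
    fun I _ => (weakSmoothAt_transition_and_chartD hy hy' _).1]
  conv_rhs => rw [h', chartD_sum_smul (fun I _ => hf.repr I) fun I _ => weakSmoothAt_const _]
  simp only [(weakSmoothAt_transition_and_chartD hy hy' _).2, chartD_const, smul_zero, add_zero,
    map_sum, map_mul]
  refine Finset.sum_congr rfl fun I _ => ?_
  rw [← map_sum]
  congr 1
  exact sum_apply_frame_smul_eq hy
    (mvfderiv 𝓘(ℝ, E) (fun z => (modelBasis E).repr (f z) I) y : TangentSpace 𝓘(ℝ, E) y →ₗ[ℝ] ℝ)

/-! ### The exterior derivative of differential forms -/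

lemma eventually_transition (hy : y ∈ (chartAt E x₀).source) (α : ∀ z : M, CotangentAlgebra E z) :
    ∀ᶠ z in nhds y, toModel E x₁ z (α z) = transition E x₀ x₁ z (toModel E x₀ z (α z)) := by
  filter_upwards [(chartAt E x₀).open_source.mem_nhds hy] with z hz
  rw [transition, AlgHom.comp_apply, ofModel_toModel hz]

/-- Smoothness at `y` is defined through the chart at `y`; this transfers it to any chart around
`y`. -/
lemma SmoothFormAt.weakSmoothAt {α : ∀ z : M, CotangentAlgebra E z} (hα : SmoothFormAt α y)
    (hy : y ∈ (chartAt E x₀).source) : WeakSmoothAt E (fun z => toModel E x₀ z (α z)) y :=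
  ((smoothFormAt_iff.1 hα).transition (mem_chart_source E y) hy).congr
    (eventually_transition (mem_chart_source E y) α)

/-- The exterior derivative of a form, calculated at each point in the preferred chart. -/
def extD (α : ∀ z : M, CotangentAlgebra E z) (x : M) : CotangentAlgebra E x :=
  ofModel E x x (chartD x (fun z => toModel E x z (α z)) x)

/-- In `extD` the chart changes with the point. Here one fixed chart serves all points of its
domain, as is needed to see that `extD α` is smooth and to differentiate it again. -/
lemma toModel_extD {α : ∀ z : M, CotangentAlgebra E z} (hα : SmoothFormAt α y)
    (hy : y ∈ (chartAt E x₀).source) :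
    toModel E x₀ y (extD α y) = chartD x₀ (fun z => toModel E x₀ z (α z)) y := by
  rw [chartD_congr (eventually_transition (mem_chart_source E y) α),
    chartD_transition (mem_chart_source E y) hy (hα.weakSmoothAt (mem_chart_source E y))]
  rfl

lemma SmoothFormAt.extD {α : ∀ z : M, CotangentAlgebra E z} (hα : ∀ y, SmoothFormAt α y) (x : M) :
    SmoothFormAt (extD α) x := by
  rw [smoothFormAt_iff]
  refine WeakSmoothAt.congr (((hα x).weakSmoothAt (mem_chart_source E x)).chartD
    (mem_chart_source E x)) ?_
  filter_upwards [(chartAt E x).open_source.mem_nhds (mem_chart_source E x)] with z hz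
  exact toModel_extD (hα z) hz

/-- The exterior derivative of differential forms. -/
def exteriorDerivative : Forms E M →ₗ[ℝ] Forms E M where
  toFun α := ⟨extD α.1, SmoothFormAt.extD α.2⟩
  map_add' α β := by
    refine Subtype.ext (funext fun x => ?_)
    have h := chartD_add (x₀ := x) ((α.2 x).weakSmoothAt (mem_chart_source E x))
      ((β.2 x).weakSmoothAt (mem_chart_source E x))
    simp only [← map_add] at h
    exact (congrArg (ofModel E x x) h).trans (map_add _ _ _)
  map_smul' r α := by
    refine Subtype.ext (funext fun x => ?_)
    -- Homogeneity is the Leibniz rule with a constant first factor, whose derivative vanishes.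
    have h := chartD_mul (x₀ := x) (weakSmoothAt_const (algebraMap ℝ _ r))
      ((α.2 x).weakSmoothAt (mem_chart_source E x))
    simp only [← Algebra.smul_def, AlgHom.commutes, chartD_const, zero_mul, zero_add,
      ← map_smul] at h
    exact congrArg (ofModel E x x) h |>.trans (map_smul _ _ _)

lemma exteriorDerivative_apply (α : Forms E M) (x : M) :
    (exteriorDerivative α).1 x = extD α.1 x := rfl

/-- The grade involution of differential forms. -/
def formInvolution : Forms E M →ₗ[ℝ] Forms E M where
  toFun α := ⟨fun x => gradeInvolution (α.1 x), fun x => by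
    have h := (smoothFormAt_iff.1 (α.2 x)).map (gradeInvolution (V := E)).toLinearMap
    refine smoothFormAt_iff.2 (h.congr (Filter.Eventually.of_forall fun y => ?_))
    exact (gradeInvolution_map _ _).symm⟩
  map_add' _ _ := Subtype.ext (funext fun _ => map_add _ _ _)
  map_smul' r α := Subtype.ext (funext fun x => gradeInvolution.toLinearMap.map_smul r (α.1 x))

lemma exteriorDerivative_mul (α β : Forms E M) :
    exteriorDerivative (α * β) =
      exteriorDerivative α * β + formInvolution α * exteriorDerivative β := by
  refine Subtype.ext (funext fun x => ?_)
  have h := chartD_mul (x₀ := x) ((α.2 x).weakSmoothAt (mem_chart_source E x))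
    ((β.2 x).weakSmoothAt (mem_chart_source E x))
  simp only [← map_mul] at h
  refine (congrArg (ofModel E x x) h).trans ?_
  rw [map_add, map_mul, map_mul, ofModel_toModel (mem_chart_source E x)]
  refine congrArg₂ _ rfl (congrArg₂ _ ?_ rfl)
  refine (congrArg (ofModel E x x) (gradeInvolution_map _ _)).trans ?_
  change ofModel E x x (toModel E x x (gradeInvolution (α.1 x))) = gradeInvolution (α.1 x)
  exact ofModel_toModel (mem_chart_source E x) _

lemma exteriorDerivative_exteriorDerivative (α : Forms E M) :
    exteriorDerivative (exteriorDerivative α) = 0 := by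
  refine Subtype.ext (funext fun x => ?_)
  have h : ∀ᶠ z in nhds x, toModel E x z (extD α.1 z) =
      chartD x (fun z => toModel E x z (α.1 z)) z := by
    filter_upwards [(chartAt E x).open_source.mem_nhds (mem_chart_source E x)] with z hz
    exact toModel_extD (α.2 z) hz
  change ofModel E x x (chartD x (fun z => toModel E x z (extD α.1 z)) x) = 0
  rw [chartD_congr h, chartD_chartD (mem_chart_source E x)
    ((α.2 x).weakSmoothAt (mem_chart_source E x)), map_zero]

lemma extD_mem_exteriorPower {p : ℕ} {α : Forms E M}
    (hα : ∀ x, α.1 x ∈ ⋀[ℝ]^p (Dual ℝ (TangentSpace 𝓘(ℝ, E) x))) (x : M) :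
    extD α.1 x ∈ ⋀[ℝ]^(p + 1) (Dual ℝ (TangentSpace 𝓘(ℝ, E) x)) :=
  map_mem_exteriorPower _ (sum_mem fun _ _ => ι_mul_mem_exteriorPower _
    (modelDeriv_mem _ ((α.2 x).weakSmoothAt (mem_chart_source E x))
      (fun y => map_mem_exteriorPower _ (hα y)) _))

end ExteriorDerivative

end

end QuantumDeRham

namespace QuantumDeRham

noncomputable section

/-! ### Torsion-free connections: d = ∑ eⁱ ∧ ∇_{e_i}. -/

section Torsion

set_option linter.unusedSectionVars false

variable {E : Type*} [NormedAddCommGroup E] [NormedSpace ℝ E] [FiniteDimensional ℝ E]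
  {M : Type*} [TopologicalSpace M] [ChartedSpace E M] [IsManifold 𝓘(ℝ, E) ∞ M]

lemma mdifferentiableAt_frame (x : M) (i : Fin (finrank ℝ E)) :
    MDifferentiableAt 𝓘(ℝ, E) (𝓘(ℝ, E).prod 𝓘(ℝ, E))
      (fun y => TotalSpace.mk' E y (frame E x i y)) x := by
  let e := trivializationAt E (TangentSpace 𝓘(ℝ, E) : M → Type _) x
  have h : ContMDiffOn 𝓘(ℝ, E) (𝓘(ℝ, E).prod 𝓘(ℝ, E)) 1
      (fun y => TotalSpace.mk' E y (frame E x i y)) e.baseSet := by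
    rw [e.contMDiffOn_section_baseSet_iff]
    refine (contMDiffOn_const (c := finBasis ℝ E i)).congr fun y hy => ?_
    rw [frame_eq, Trivialization.symmL_apply _ hy]
    exact congrArg Prod.snd (e.apply_mk_symm hy _)
  exact (h.contMDiffAt (e.open_baseSet.mem_nhds
    (FiberBundle.mem_baseSet_trivializationAt' x))).mdifferentiableAt one_ne_zero

/-- Pulled back by the inverse chart, the frame fields are constant near the point in question. -/
lemma mlieBracket_frame (x : M) (i j : Fin (finrank ℝ E)) :
    VectorField.mlieBracket 𝓘(ℝ, E) (frame E x i) (frame E x j) x = 0 := by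
  have h (k) : VectorField.mpullbackWithin 𝓘(ℝ, E) 𝓘(ℝ, E) (extChartAt 𝓘(ℝ, E) x).symm
      (frame E x k) (Set.range 𝓘(ℝ, E)) =ᶠ[nhds (extChartAt 𝓘(ℝ, E) x x)]
      fun _ => finBasis ℝ E k := by
    filter_upwards [extChartAt_target_mem_nhds x] with z hz
    have hz' : (extChartAt 𝓘(ℝ, E) x).symm z ∈ (chartAt E x).source := by
      simpa using (extChartAt 𝓘(ℝ, E) x).map_target hz
    rw [VectorField.mpullbackWithin_apply, frame_eq, TangentBundle.symmL_trivializationAt hz',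
      (extChartAt 𝓘(ℝ, E) x).right_inv hz]
    exact (isInvertible_mfderivWithin_extChartAt_symm hz).inverse_apply_eq.2 rfl
  rw [← VectorField.mlieBracketWithin_univ, VectorField.mlieBracketWithin_apply,
    (h i).lieBracketWithin_vectorField_eq_nhds (h j)]
  simp only [VectorField.lieBracketWithin_eq, fderivWithin_fun_const, Pi.zero_apply,
    zero_apply, sub_self]
  exact map_zero _

/-- Symmetry of the Christoffel symbols in their lower indices: the torsion on two frame fields,
whose bracket vanishes. -/
lemma covariantDerivative_frame_comm
    (cov : CovariantDerivative 𝓘(ℝ, E) E (TangentSpace 𝓘(ℝ, E) : M → Type _))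
    (htorsion : cov.torsion = 0) (x : M) (i j : Fin (finrank ℝ E)) :
    cov (frame E x j) x (frame E x i x) = cov (frame E x i) x (frame E x j x) := by
  have h := cov.torsion_eq_zero_iff.1 htorsion (mdifferentiableAt_frame x i)
    (mdifferentiableAt_frame x j)
  rwa [mlieBracket_frame, sub_eq_zero] at h

lemma coframe_frame {x y : M} (hy : y ∈ (chartAt E x).source) (i j : Fin (finrank ℝ E)) :
    coframe E x i y (frame E x j y) = if j = i then 1 else 0 := by
  have h : coframe E x i y (frame E x j y) = (finBasis ℝ E).coord i (finBasis ℝ E j) :=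
    congrArg ((finBasis ℝ E).coord i) (continuousLinearMapAt_symmL hy _)
  rw [h, Basis.coord_apply, Basis.repr_self, Finsupp.single_apply]

lemma mvfderiv_coframe_frame (x : M) (i j : Fin (finrank ℝ E)) :
    mvfderiv 𝓘(ℝ, E) (fun y => coframe E x i y (frame E x j y)) x = 0 := by
  have h : (fun y => coframe E x i y (frame E x j y)) =ᶠ[nhds x]
      fun _ => if j = i then 1 else 0 := by
    filter_upwards [(chartAt E x).open_source.mem_nhds (mem_chart_source E x)] with y hy
    exact coframe_frame hy i j
  rw [mvfderiv_congr h, mvfderiv_const]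

/-- The pairings of coframe and frame are locally constant, so only the Christoffel term of the dual
connection remains. -/
lemma cotangentConnection_coframe
    (cov : CovariantDerivative 𝓘(ℝ, E) E (TangentSpace 𝓘(ℝ, E) : M → Type _)) (x : M)
    (i : Fin (finrank ℝ E)) (v : TangentSpace 𝓘(ℝ, E) x) :
    cotangentConnection cov (coframe E x i) x v =
      -∑ j, coframe E x i x (cov (frame E x j) x v) • coframe E x j x := by
  rw [← Finset.sum_neg_distrib]
  refine Finset.sum_congr rfl fun j _ => ?_
  rw [mvfderiv_coframe_frame, zero_apply, zero_sub]
  exact neg_smul (coframe E x i x (cov (frame E x j) x v)) (coframe E x j x)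

/-- The frame of the chart at `x` as a basis of a tangent space. -/
def frameBasis {x y : M} (hy : y ∈ (chartAt E x).source) :
    Basis (Fin (finrank ℝ E)) ℝ (TangentSpace 𝓘(ℝ, E) y) :=
  (finBasis ℝ E).map ((trivializationAt E (TangentSpace 𝓘(ℝ, E) : M → Type _)
    x).continuousLinearEquivAt ℝ y (mem_baseSet_iff.2 hy)).symm.toLinearEquiv

lemma frameBasis_apply {x y : M} (hy : y ∈ (chartAt E x).source) (i) :
    frameBasis hy i = frame E x i y := by
  rw [frame_eq, Trivialization.symmL_apply _ (mem_baseSet_iff.2 hy)]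
  simp [frameBasis]

lemma frameBasis_coord {x y : M} (hy : y ∈ (chartAt E x).source) (i) :
    (frameBasis hy).coord i = coframe E x i y := by
  ext v
  simp [frameBasis, coframe, Trivialization.coe_linearMapAt_of_mem _ (mem_baseSet_iff.2 hy)]

/-- The covariant derivative of a form in terms of the derivative in the chart. -/
lemma formConnection_eq
    (cov : CovariantDerivative 𝓘(ℝ, E) E (TangentSpace 𝓘(ℝ, E) : M → Type _))
    (α : ∀ y : M, CotangentAlgebra E y) (x : M) (v : TangentSpace 𝓘(ℝ, E) x) :
    formConnection cov α x v =
      ofModel E x x (modelDeriv (fun y => toModel E x y (α y)) x v) +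
        ∑ j, ExteriorAlgebra.ι ℝ (cotangentConnection cov (coframe E x j) x v) *
          leftContraction (frame E x j x) (α x) := by
  rw [formConnection, modelDeriv_apply, map_sum]
  simp only [map_smul]
  rfl

/-- The covariant derivative of a form as a linear map on the tangent space. -/
def formConnectionHom
    (cov : CovariantDerivative 𝓘(ℝ, E) E (TangentSpace 𝓘(ℝ, E) : M → Type _))
    (α : ∀ y : M, CotangentAlgebra E y) (x : M) :
    TangentSpace 𝓘(ℝ, E) x →ₗ[ℝ] CotangentAlgebra E x where
  toFun := formConnection cov α x
  map_add' u v := by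
    simp only [formConnection_eq, cotangentConnection_coframe, map_add, add_smul,
      Finset.sum_add_distrib, neg_add, add_mul]
    abel
  map_smul' r v := by
    simp only [formConnection_eq, cotangentConnection_coframe, map_smul, smul_assoc, ← Finset.smul_sum,
      ← smul_neg, RingHom.id_apply, smul_mul_assoc, smul_add]

lemma formConnectionHom_apply
    (cov : CovariantDerivative 𝓘(ℝ, E) E (TangentSpace 𝓘(ℝ, E) : M → Type _))
    (α : ∀ y : M, CotangentAlgebra E y) (x : M) (v : TangentSpace 𝓘(ℝ, E) x) :
    formConnectionHom cov α x v = formConnection cov α x v := rfl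

/-- A torsion-free connection computes the exterior derivative. -/
lemma extD_eq_sum_formConnection
    (cov : CovariantDerivative 𝓘(ℝ, E) E (TangentSpace 𝓘(ℝ, E) : M → Type _))
    (htorsion : cov.torsion = 0) (α : ∀ y : M, CotangentAlgebra E y) (x : M)
    {ι : Type*} [Fintype ι] (e : Basis ι ℝ (TangentSpace 𝓘(ℝ, E) x)) :
    ∑ i, ExteriorAlgebra.ι ℝ (e.coord i) * formConnection cov α x (e i) = extD α x := by
  -- The sum ∑ eⁱ ∧ ∇_{e_i} α contracts a bilinear expression in covector and vector, so the given
  -- basis may be exchanged for the frame of the chart.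
  have h1 := sum_coord_basis (((LinearMap.mul ℝ (CotangentAlgebra E x)).compl₁₂
    (ExteriorAlgebra.ι ℝ) (formConnectionHom cov α x))) e (frameBasis (mem_chart_source E x))
  simp only [LinearMap.compl₁₂_apply, LinearMap.mul_apply', formConnectionHom_apply,
    frameBasis_apply, frameBasis_coord] at h1
  rw [h1]
  simp only [formConnection_eq, mul_add, Finset.sum_add_distrib]
  have h2 : extD α x = ∑ i, ExteriorAlgebra.ι ℝ (coframe E x i x) *
      ofModel E x x (modelDeriv (fun y => toModel E x y (α y)) x (frame E x i x)) := by
    simp only [extD, chartD, map_sum, map_mul, ofModel_modelCovector]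
  rw [h2, add_eq_left]
  simp only [Finset.mul_sum]
  rw [Finset.sum_comm]
  refine Finset.sum_eq_zero fun j _ => ?_
  -- For fixed `j` the connection terms form -∑ Γʲᵢₖ eⁱ ∧ eᵏ ∧ (e_j ⌟ α), which vanishes because
  -- Γʲᵢₖ is symmetric in i and k.
  have h3 := sum_ι_mul_ι_eq_zero (fun i => coframe E x i x) (fun i k =>
    -(coframe E x j x (cov (frame E x k) x (frame E x i x)) •
      leftContraction (frame E x j x) (α x)))
    fun i k => by rw [covariantDerivative_frame_comm cov htorsion]
  rw [← h3]
  refine Finset.sum_congr rfl fun i _ => ?_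
  simp only [cotangentConnection_coframe, map_neg, map_sum, map_smul, neg_mul, mul_neg,
    Finset.sum_mul, Finset.mul_sum, smul_mul_assoc, mul_smul_comm, Finset.sum_neg_distrib]

end Torsion

end

end QuantumDeRham

namespace QuantumDeRham

noncomputable section

/-! ### Derivations of Λ(V*) and the insertion of a bivector. -/

section FiberDerivation

variable {V : Type*} [AddCommGroup V] [Module ℝ V] {ι : Type*} [Fintype ι]

/-- When `b` is a basis, ∑ φ_k ∧ (b_k ⌟ ·) is the derivation sending the dual basis to the φ_k. Its
commutator with a contraction is the contraction with the transposed image of `v`. -/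
lemma leftContraction_sum_ι_mul (b : ι → V) (φ : ι → Dual ℝ V) (v : V)
    (a : ExteriorAlgebra ℝ (Dual ℝ V)) :
    leftContraction v (∑ k, ExteriorAlgebra.ι ℝ (φ k) * leftContraction (b k) a) =
      ∑ k, ExteriorAlgebra.ι ℝ (φ k) * leftContraction (b k) (leftContraction v a) +
        ∑ k, φ k v • leftContraction (b k) a := by
  rw [map_sum, ← Finset.sum_add_distrib]
  refine Finset.sum_congr rfl fun k _ => ?_
  rw [leftContraction_ι_mul, leftContraction_comm v, mul_neg, sub_neg_eq_add, add_comm]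

/-- The commutator of the insertion of a bivector with a derivation of `Λ(V*)`. -/
lemma bivectorInsertion_sum_ι_mul [FiniteDimensional ℝ V] (w : LinearMap.BilinForm ℝ (Dual ℝ V))
    (b : Basis ι ℝ V) (φ : ι → Dual ℝ V) (a : ExteriorAlgebra ℝ (Dual ℝ V)) :
    bivectorInsertion w (∑ k, ExteriorAlgebra.ι ℝ (φ k) * leftContraction (b k) a) =
      ∑ k, ExteriorAlgebra.ι ℝ (φ k) * leftContraction (b k) (bivectorInsertion w a) +
        (2⁻¹ : ℝ) • ∑ i, ∑ j, (w (φ i) (b.coord j) + w (b.coord i) (φ j)) •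
          leftContraction (b j) (leftContraction (b i) a) := by
  have hφ (k) : ∑ i, φ k (b i) • b.coord i = φ k := b.sum_dual_apply_smul_coord (φ k)
  -- Expanding φ_k = ∑ φ_k(b_i) bⁱ moves the coefficients from the contractions into the arguments
  -- of `w`; `h2` does the same in the other slot.
  have h1 : ∑ i, ∑ j, w (b.coord i) (b.coord j) •
      ∑ k, φ k (b i) • leftContraction (b j) (leftContraction (b k) a) =
      ∑ i, ∑ j, w (φ i) (b.coord j) • leftContraction (b j) (leftContraction (b i) a) := by
    simp only [Finset.smul_sum, smul_smul]
    rw [Finset.sum_comm, Finset.sum_comm' (t' := Finset.univ) (s' := fun _ => Finset.univ) (by simp)]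
    conv_rhs => rw [Finset.sum_comm]
    conv_lhs => rw [Finset.sum_comm]
    refine Finset.sum_congr rfl fun j _ => ?_
    rw [Finset.sum_comm]
    refine Finset.sum_congr rfl fun k _ => ?_
    rw [← Finset.sum_smul]
    congr 1
    conv_rhs => rw [← hφ k]
    simp only [map_sum, map_smul, LinearMap.sum_apply, LinearMap.smul_apply, smul_eq_mul]
    exact Finset.sum_congr rfl fun i _ => mul_comm _ _
  have h2 : ∑ i, ∑ j, w (b.coord i) (b.coord j) •
      ∑ k, φ k (b j) • leftContraction (b k) (leftContraction (b i) a) =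
      ∑ i, ∑ j, w (b.coord i) (φ j) • leftContraction (b j) (leftContraction (b i) a) := by
    refine Finset.sum_congr rfl fun i _ => ?_
    simp only [Finset.smul_sum, smul_smul]
    rw [Finset.sum_comm]
    refine Finset.sum_congr rfl fun k _ => ?_
    rw [← Finset.sum_smul]
    congr 1
    conv_rhs => rw [← hφ k]
    simp only [map_sum, map_smul, smul_eq_mul]
    exact Finset.sum_congr rfl fun i _ => mul_comm _ _
  have h3 : ∑ k, ExteriorAlgebra.ι ℝ (φ k) * leftContraction (b k) (bivectorInsertion w a) =
      (2⁻¹ : ℝ) • ∑ i, ∑ j, w (b.coord i) (b.coord j) • ∑ k, ExteriorAlgebra.ι ℝ (φ k) *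
        leftContraction (b k) (leftContraction (b j) (leftContraction (b i) a)) := by
    simp only [bivectorInsertion_apply w b, map_smul, map_sum, mul_smul_comm, Finset.mul_sum,
      ← Finset.smul_sum]
    congr 1
    rw [Finset.sum_comm]
    refine Finset.sum_congr rfl fun i _ => ?_
    rw [Finset.sum_comm]
    simp only [Finset.smul_sum]
  rw [h3, bivectorInsertion_apply w b]
  have h4 (i j) : leftContraction (b j) (leftContraction (b i)
      (∑ k, ExteriorAlgebra.ι ℝ (φ k) * leftContraction (b k) a)) =
      ∑ k, ExteriorAlgebra.ι ℝ (φ k) *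
        leftContraction (b k) (leftContraction (b j) (leftContraction (b i) a)) +
      (∑ k, φ k (b i) • leftContraction (b j) (leftContraction (b k) a) +
        ∑ k, φ k (b j) • leftContraction (b k) (leftContraction (b i) a)) := by
    rw [leftContraction_sum_ι_mul, map_add, leftContraction_sum_ι_mul, map_sum _ (fun k =>
      φ k (b i) • leftContraction (b k) a), add_assoc, add_comm (∑ k, φ k (b j) • _)]
    simp only [map_smul]
  simp only [h4, smul_add, Finset.sum_add_distrib, add_smul, h1, h2]

end FiberDerivation

/-! ### Parallel bivector fields and the splitting d_h = d + hδ with δ = [Λ, d]. -/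

section Parallel

set_option linter.unusedSectionVars false

variable {E : Type*} [NormedAddCommGroup E] [NormedSpace ℝ E] [FiniteDimensional ℝ E]
  {M : Type*} [TopologicalSpace M] [ChartedSpace E M] [IsManifold 𝓘(ℝ, E) ∞ M]

lemma toModel_leftContraction_frame {x y : M} (i) (a : CotangentAlgebra E y) :
    toModel E x y (leftContraction (frame E x i y) a) =
      leftContraction (finBasis ℝ E i) (toModel E x y a) :=
  map_leftContraction _ _ _

lemma ofModel_leftContraction {x y : M} (hy : y ∈ (chartAt E x).source) (i)
    (a : ExteriorAlgebra ℝ (Dual ℝ E)) :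
    ofModel E x y (leftContraction (finBasis ℝ E i) a) =
      leftContraction (frame E x i y) (ofModel E x y a) := by
  rw [← ofModel_toModel hy (leftContraction (frame E x i y) (ofModel E x y a)),
    toModel_leftContraction_frame, toModel_ofModel hy]

lemma bivectorInsertion_frame (w : BivectorField E M) {x y : M} (hy : y ∈ (chartAt E x).source)
    (a : CotangentAlgebra E y) :
    bivectorInsertion (w.toFun y) a = (2⁻¹ : ℝ) • ∑ i, ∑ j,
      w.toFun y (coframe E x i y) (coframe E x j y) •
        leftContraction (frame E x j y) (leftContraction (frame E x i y) a) := by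
  simp only [bivectorInsertion_apply _ (frameBasis hy), frameBasis_apply, frameBasis_coord]

lemma toModel_bivectorInsertion (w : BivectorField E M) {x y : M}
    (hy : y ∈ (chartAt E x).source) (a : CotangentAlgebra E y) :
    toModel E x y (bivectorInsertion (w.toFun y) a) = (2⁻¹ : ℝ) • ∑ i, ∑ j,
      w.toFun y (coframe E x i y) (coframe E x j y) •
        (leftContraction (finBasis ℝ E j) ∘ₗ leftContraction (finBasis ℝ E i))
          (toModel E x y a) := by
  simp only [bivectorInsertion_frame w hy, map_smul, map_sum, toModel_leftContraction_frame,
    LinearMap.comp_apply]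

lemma smoothFormAt_bivectorInsertion (w : BivectorField E M) {α : ∀ y : M, CotangentAlgebra E y}
    {x : M} (hα : SmoothFormAt α x) :
    SmoothFormAt (fun y => bivectorInsertion (w.toFun y) (α y)) x := by
  rw [smoothFormAt_iff] at *
  have h : WeakSmoothAt E (fun y => (2⁻¹ : ℝ) • ∑ i, ∑ j,
      w.toFun y (coframe E x i y) (coframe E x j y) •
        (leftContraction (finBasis ℝ E j) ∘ₗ leftContraction (finBasis ℝ E i))
          (toModel E x y (α y))) x :=
    (WeakSmoothAt.sum fun i _ => WeakSmoothAt.sum fun j _ =>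
      (hα.map _).smul (w.smooth x i j)).smul contMDiffAt_const
  refine h.congr ?_
  filter_upwards [(chartAt E x).open_source.mem_nhds (mem_chart_source E x)] with y hy
  exact toModel_bivectorInsertion w hy _

lemma smoothFormAt_ι_coframe (x : M) (i) :
    SmoothFormAt (fun y => ExteriorAlgebra.ι ℝ (coframe E x i y)) x := by
  rw [smoothFormAt_iff]
  refine (weakSmoothAt_const (modelCovector E i)).congr ?_
  filter_upwards [(chartAt E x).open_source.mem_nhds (mem_chart_source E x)] with y hy
  rw [← ofModel_modelCovector, toModel_ofModel hy]

/-- The insertion of a parallel bivector field commutes with covariant derivatives. -/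
lemma formConnection_bivectorInsertion {w : BivectorField E M}
    {cov : CovariantDerivative 𝓘(ℝ, E) E (TangentSpace 𝓘(ℝ, E) : M → Type _)}
    (hparallel : w.IsParallel cov) {α : ∀ y : M, CotangentAlgebra E y} {x : M}
    (hα : SmoothFormAt α x) (v : TangentSpace 𝓘(ℝ, E) x) :
    formConnection cov (fun y => bivectorInsertion (w.toFun y) (α y)) x v =
      bivectorInsertion (w.toFun x) (formConnection cov α x v) := by
  have hx := mem_chart_source E x
  have h1 : ∀ᶠ y in nhds x, toModel E x y (bivectorInsertion (w.toFun y) (α y)) =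
      (2⁻¹ : ℝ) • ∑ i, ∑ j, w.toFun y (coframe E x i y) (coframe E x j y) •
        (leftContraction (finBasis ℝ E j) ∘ₗ leftContraction (finBasis ℝ E i))
          (toModel E x y (α y)) := by
    filter_upwards [(chartAt E x).open_source.mem_nhds hx] with y hy
    exact toModel_bivectorInsertion w hy _
  have hα' := smoothFormAt_iff.1 hα
  have h2 (i j) := (hα'.map (leftContraction (finBasis ℝ E j) ∘ₗ
    leftContraction (finBasis ℝ E i))).smul (w.smooth x i j)
  -- Product rule for ½ ∑ wⁱʲ e_j ⌟ e_i ⌟ α in the chart, where the contractions are constant; the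
  -- derivative of wⁱʲ is replaced by means of ∇w = 0.
  have h3 : modelDeriv (fun y => toModel E x y (bivectorInsertion (w.toFun y) (α y))) x v =
      (2⁻¹ : ℝ) • ∑ i, ∑ j,
        ((w.toFun x (cotangentConnection cov (coframe E x i) x v) (coframe E x j x) +
          w.toFun x (coframe E x i x) (cotangentConnection cov (coframe E x j) x v)) •
          leftContraction (finBasis ℝ E j) (leftContraction (finBasis ℝ E i)
            (toModel E x x (α x))) +
        w.toFun x (coframe E x i x) (coframe E x j x) •
          leftContraction (finBasis ℝ E j) (leftContraction (finBasis ℝ E i)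
            (modelDeriv (fun y => toModel E x y (α y)) x v))) := by
    rw [modelDeriv_congr h1, modelDeriv_smul contMDiffAt_const
      (WeakSmoothAt.sum fun i _ => WeakSmoothAt.sum fun j _ => h2 i j), mvfderiv_const,
      modelDeriv_sum fun i _ => WeakSmoothAt.sum fun j _ => h2 i j]
    rw [zero_apply, zero_smul, zero_add, LinearMap.sum_apply]
    congr 1
    refine Finset.sum_congr rfl fun i _ => ?_
    rw [modelDeriv_sum fun j _ => h2 i j, LinearMap.sum_apply]
    refine Finset.sum_congr rfl fun j _ => ?_
    rw [modelDeriv_smul (w.smooth x i j) (hα'.map _), modelDeriv_map hα',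
      hparallel x v _ _ (smoothFormAt_ι_coframe x i) (smoothFormAt_ι_coframe x j)]
    rfl
  -- The commutator of Λ with the connection term produces exactly the sum that comes from the
  -- derivatives of wⁱʲ in `h3`.
  have h4 := bivectorInsertion_sum_ι_mul (w.toFun x) (frameBasis hx)
    (fun k => cotangentConnection cov (coframe E x k) x v) (α x)
  simp only [frameBasis_apply, frameBasis_coord] at h4
  rw [formConnection_eq, formConnection_eq, map_add, h4, h3, bivectorInsertion_frame w hx (ofModel E x x _)]
  simp only [map_smul, map_sum, map_add, ofModel_leftContraction hx, ofModel_toModel hx,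
    Finset.sum_add_distrib, smul_add]
  abel

variable (w : BivectorField E M)

/-- The insertion of a bivector field into differential forms. -/
def formInsertion : Forms E M →ₗ[ℝ] Forms E M where
  toFun α := ⟨fun x => bivectorInsertion (w.toFun x) (α.1 x),
    fun x => smoothFormAt_bivectorInsertion w (α.2 x)⟩
  map_add' _ _ := Subtype.ext (funext fun _ => map_add _ _ _)
  map_smul' _ _ := Subtype.ext (funext fun x => map_smul (bivectorInsertion (w.toFun x)) _ _)

/-- The part `∑ᵢⱼ wⁱʲ e_j ⌟ ∇_{e_i}` of the quantum differential, as the commutator of the insertion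
of the bivector field and the exterior derivative. -/
def codifferential : Forms E M →ₗ[ℝ] Forms E M :=
  formInsertion w ∘ₗ exteriorDerivative - exteriorDerivative ∘ₗ formInsertion w

lemma codifferential_apply (α : Forms E M) : codifferential w α =
    formInsertion w (exteriorDerivative α) - exteriorDerivative (formInsertion w α) := rfl

variable {w} {cov : CovariantDerivative 𝓘(ℝ, E) E (TangentSpace 𝓘(ℝ, E) : M → Type _)}

lemma extD_formInsertion (htorsion : cov.torsion = 0) (hparallel : w.IsParallel cov)
    (α : Forms E M) (x : M) {ι : Type*} [Fintype ι] (e : Basis ι ℝ (TangentSpace 𝓘(ℝ, E) x)) :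
    (exteriorDerivative (formInsertion w α)).1 x = ∑ i, ExteriorAlgebra.ι ℝ (e.coord i) *
      bivectorInsertion (w.toFun x) (formConnection cov α.1 x (e i)) := by
  rw [exteriorDerivative_apply, ← extD_eq_sum_formConnection cov htorsion _ x e]
  refine Finset.sum_congr rfl fun i _ => ?_
  rw [← formConnection_bivectorInsertion hparallel (α.2 x)]
  rfl

lemma quantumDifferentialAt_coeff_zero (htorsion : cov.torsion = 0)
    (α : Forms E M) (x : M) {ι : Type*} [Fintype ι] (e : Basis ι ℝ (TangentSpace 𝓘(ℝ, E) x)) :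
    (quantumDifferentialAt w cov α x e).coeff 0 = (exteriorDerivative α).1 x := by
  simp only [quantumDifferentialAt, finsetSum_coeff, quantumWedge_coeff, quantumWedgeCoeff_zero]
  exact extD_eq_sum_formConnection cov htorsion α.1 x e

/-- Summing [Λ, eⁱ ∧ ·] applied to ∇_{e_i} α gives Λdα - ∑ eⁱ ∧ Λ∇_{e_i} α, and the last sum is dΛα
because Λ commutes with ∇. -/
lemma quantumDifferentialAt_coeff_one (htorsion : cov.torsion = 0) (hparallel : w.IsParallel cov)
    (α : Forms E M) (x : M) {ι : Type*} [Fintype ι] (e : Basis ι ℝ (TangentSpace 𝓘(ℝ, E) x)) :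
    (quantumDifferentialAt w cov α x e).coeff 1 = (codifferential w α).1 x := by
  simp only [quantumDifferentialAt, finsetSum_coeff, quantumWedge_coeff,
    quantumWedgeCoeff_one_ι (w.isAlt x), Finset.sum_sub_distrib, ← map_sum]
  rw [extD_eq_sum_formConnection cov htorsion α.1 x e, ← extD_formInsertion htorsion hparallel]
  rfl

lemma quantumDifferentialAt_coeff_add_two (α : Forms E M) (x : M) (k : ℕ) {ι : Type*} [Fintype ι]
    (e : Basis ι ℝ (TangentSpace 𝓘(ℝ, E) x)) :
    (quantumDifferentialAt w cov α x e).coeff (k + 2) = 0 := by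
  simp only [quantumDifferentialAt, finsetSum_coeff, quantumWedge_coeff,
    quantumWedgeCoeff_ι_eq_zero, Finset.sum_const_zero]

/-- This is [Λ, [Λ, d]] = 0. With d = ∑ eⁱ ∧ ∇_{e_i} and [Λ, ∇] = 0 it reduces to the fibrewise
identity [Λ, [Λ, eⁱ ∧ ·]] = 0. -/
lemma formInsertion_codifferential (htorsion : cov.torsion = 0) (hparallel : w.IsParallel cov)
    (α : Forms E M) :
    formInsertion w (codifferential w α) = codifferential w (formInsertion w α) := by
  have h : formInsertion w (formInsertion w (exteriorDerivative α)) =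
      (2 : ℝ) • formInsertion w (exteriorDerivative (formInsertion w α)) -
        exteriorDerivative (formInsertion w (formInsertion w α)) := by
    refine Subtype.ext (funext fun x => ?_)
    let e := frameBasis (mem_chart_source E x)
    change bivectorInsertion (w.toFun x) (bivectorInsertion (w.toFun x) (extD α.1 x)) =
      (2 : ℝ) • bivectorInsertion (w.toFun x) ((exteriorDerivative (formInsertion w α)).1 x) -
        (exteriorDerivative (formInsertion w (formInsertion w α))).1 x
    rw [extD_formInsertion htorsion hparallel α x e,
      extD_formInsertion htorsion hparallel (formInsertion w α) x e,
      ← extD_eq_sum_formConnection cov htorsion α.1 x e, map_sum, map_sum, map_sum,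
      Finset.smul_sum, ← Finset.sum_sub_distrib]
    refine Finset.sum_congr rfl fun i _ => ?_
    rw [bivectorInsertion_ι_mul (w.isAlt x), ← formConnection_bivectorInsertion hparallel (α.2 x)]
    rfl
  rw [codifferential_apply, codifferential_apply, map_sub, h]
  module

end Parallel

end

end QuantumDeRham

namespace QuantumDeRham

noncomputable section

/-! ### The Leibniz rule and the square of d + hδ, coefficient by coefficient; degrees. -/

section FormCalculus

set_option linter.unusedSectionVars false

variable {E : Type*} [NormedAddCommGroup E] [NormedSpace ℝ E] [FiniteDimensional ℝ E]
  {M : Type*} [TopologicalSpace M] [ChartedSpace E M] [IsManifold 𝓘(ℝ, E) ∞ M]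
  (w : BivectorField E M)

/-- The coefficient of `hᵏ` in the quantum exterior product of differential forms. -/
def formWedgeCoeff (k : ℕ) : Forms E M →ₗ[ℝ] Forms E M →ₗ[ℝ] Forms E M :=
  LinearMap.mk₂ ℝ (fun α β => ⟨fun y => quantumWedgeCoeff (w.toFun y) k (α.1 y) (β.1 y),
      fun x₀ => (α.2 x₀).quantumWedgeCoeff w k (β.2 x₀)⟩)
    (fun α α' β => Subtype.ext (funext fun y => by
      change quantumWedgeCoeff (w.toFun y) k (α.1 y + α'.1 y) (β.1 y) = _
      simp only [quantumWedgeCoeff, TensorProduct.add_tmul, map_add, smul_add]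
      rfl))
    (fun r α β => Subtype.ext (funext fun y => by
      change quantumWedgeCoeff (w.toFun y) k (r • α.1 y) (β.1 y) = _
      simp only [quantumWedgeCoeff, ← TensorProduct.smul_tmul', map_smul, smul_comm _ r]
      rfl))
    (fun α β β' => Subtype.ext (funext fun y => by
      change quantumWedgeCoeff (w.toFun y) k (α.1 y) (β.1 y + β'.1 y) = _
      simp only [quantumWedgeCoeff, TensorProduct.tmul_add, map_add, smul_add]
      rfl))
    (fun r α β => Subtype.ext (funext fun y => by
      change quantumWedgeCoeff (w.toFun y) k (α.1 y) (r • β.1 y) = _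
      simp only [quantumWedgeCoeff, TensorProduct.tmul_smul, map_smul, smul_comm _ r]
      rfl))

lemma formWedgeCoeff_zero (α β : Forms E M) : formWedgeCoeff w 0 α β = α * β :=
  Subtype.ext (funext fun _ => quantumWedgeCoeff_zero _ _ _)

lemma formWedgeCoeff_eq_zero {k : ℕ} (hk : finrank ℝ E < k) (α β : Forms E M) :
    formWedgeCoeff w k α β = 0 := by
  refine Subtype.ext (funext fun x => ?_)
  have h : finrank ℝ (TangentSpace 𝓘(ℝ, E) x) < k := hk
  exact quantumWedgeCoeff_eq_zero (w.toFun x) h (α.1 x) (β.1 x)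

lemma formWedge_coeff (k : ℕ) (α β : Forms E M) :
    (formWedge w α β).coeff k = formWedgeCoeff w k α β := by
  simp only [formWedge, finsetSum_coeff, coeff_monomial, Finset.sum_ite_eq', Finset.mem_range]
  split_ifs with h
  · rfl
  · rw [formWedgeCoeff_eq_zero w (by omega)]

lemma succ_smul_formWedgeCoeff (k : ℕ) (α β : Forms E M) :
    ((k : ℝ) + 1) • formWedgeCoeff w (k + 1) α β =
      formInsertion w (formWedgeCoeff w k α β) - formWedgeCoeff w k (formInsertion w α) β -
        formWedgeCoeff w k α (formInsertion w β) :=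
  Subtype.ext (funext fun x => succ_smul_quantumWedgeCoeff (w.isAlt x) k (α.1 x) (β.1 x))

/-- The coefficient of `hᵏ` in the product of `h` and the quantum exterior product. -/
def formWedgeCoeffPred : ℕ → Forms E M →ₗ[ℝ] Forms E M →ₗ[ℝ] Forms E M
  | 0 => 0
  | k + 1 => formWedgeCoeff w k

lemma smul_formWedgeCoeff (k : ℕ) (α β : Forms E M) :
    (k : ℝ) • formWedgeCoeff w k α β = formInsertion w (formWedgeCoeffPred w k α β) -
      formWedgeCoeffPred w k (formInsertion w α) β -
        formWedgeCoeffPred w k α (formInsertion w β) := by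
  cases k with
  | zero => simp [formWedgeCoeffPred]
  | succ k => simpa [formWedgeCoeffPred] using succ_smul_formWedgeCoeff w k α β

lemma formInsertion_formInvolution (α : Forms E M) :
    formInsertion w (formInvolution α) = formInvolution (formInsertion w α) :=
  Subtype.ext (funext fun _ => bivectorInsertion_gradeInvolution _ _)

lemma formInsertion_exteriorDerivative (α : Forms E M) :
    formInsertion w (exteriorDerivative α) =
      exteriorDerivative (formInsertion w α) + codifferential w α := by
  rw [codifferential_apply]
  abel

variable {w} {cov : CovariantDerivative 𝓘(ℝ, E) E (TangentSpace 𝓘(ℝ, E) : M → Type _)}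

/-- The Leibniz rule of the quantum differential, in terms of coefficients. -/
lemma formWedgeCoeff_leibniz
    (hΛ : ∀ α, formInsertion w (codifferential w α) = codifferential w (formInsertion w α))
    (k : ℕ) (α β : Forms E M) :
    exteriorDerivative (formWedgeCoeff w k α β) + codifferential w (formWedgeCoeffPred w k α β) =
      formWedgeCoeff w k (exteriorDerivative α) β +
        formWedgeCoeffPred w k (codifferential w α) β +
        formWedgeCoeff w k (formInvolution α) (exteriorDerivative β) +
        formWedgeCoeffPred w k (formInvolution α) (codifferential w β) := by
  induction k generalizing α β with
  | zero =>
    simp [formWedgeCoeff_zero, formWedgeCoeffPred, exteriorDerivative_mul]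
  | succ k ih =>
    -- After multiplication by k + 1 the recurrence lowers every coefficient. What appears is Λ of
    -- the identity for (α, β), minus the identities for (Λα, β) and (α, Λβ). Moving Λ past d yields
    -- an extra δ each time; this supplies the 1 in k + 1 for the δ-terms, whose recurrence only
    -- accounts for k.
    have hk : (k : ℝ) + 1 ≠ 0 := by positivity
    refine smul_right_injective _ hk ?_
    have e1 := congrArg exteriorDerivative (succ_smul_formWedgeCoeff w k α β)
    have e2 := congrArg (codifferential w) (smul_formWedgeCoeff w k α β)
    have e3 := succ_smul_formWedgeCoeff w k (exteriorDerivative α) β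
    have e4 := smul_formWedgeCoeff w k (codifferential w α) β
    have e5 := succ_smul_formWedgeCoeff w k (formInvolution α) (exteriorDerivative β)
    have e6 := smul_formWedgeCoeff w k (formInvolution α) (codifferential w β)
    have i1 := congrArg (formInsertion w) (ih α β)
    have i2 := ih (formInsertion w α) β
    have i3 := ih α (formInsertion w β)
    simp only [map_add, map_sub, map_smul, LinearMap.add_apply, hΛ,
      formInsertion_formInvolution, formInsertion_exteriorDerivative] at e1 e2 e3 e4 e5 e6 i1 i2 i3
    simp only [formWedgeCoeffPred]
    linear_combination (norm := module) e1 + e2 - e3 - e4 - e5 - e6 + i1 - i2 - i3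

/-- By d² = 0, dδ = dΛd and δd = -dΛd. -/
lemma exteriorDerivative_codifferential (α : Forms E M) :
    exteriorDerivative (codifferential w α) = -codifferential w (exteriorDerivative α) := by
  simp only [codifferential_apply, map_sub, exteriorDerivative_exteriorDerivative, map_zero]
  abel

/-- As Λ commutes with δ, δ² = [Λ, d]δ = [Λ, dδ] and also δ² = δ[Λ, d] = [Λ, δd] = -[Λ, dδ]. Hence
2δ² = 0. -/
lemma codifferential_codifferential
    (hΛ : ∀ α, formInsertion w (codifferential w α) = codifferential w (formInsertion w α))
    (α : Forms E M) : codifferential w (codifferential w α) = 0 := by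
  have h1 := formInsertion_exteriorDerivative w (codifferential w α)
  have h2 := congrArg (codifferential w) (formInsertion_exteriorDerivative w α)
  rw [map_add, ← hΛ, ← neg_eq_iff_eq_neg.2 (exteriorDerivative_codifferential α), map_neg,
    ← neg_eq_iff_eq_neg.2 (exteriorDerivative_codifferential (formInsertion w α)), ← hΛ, h1] at h2
  have h3 : (2 : ℝ) • codifferential w (codifferential w α) = 0 := by
    linear_combination (norm := module) -h2
  exact (smul_eq_zero.1 h3).resolve_left two_ne_zero

/-! ### The degree of differential forms -/

lemma isOfDegree_zero (m : ℤ) : IsOfDegree m (0 : Forms E M) := by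
  cases m with
  | ofNat d => exact fun x => zero_mem _
  | negSucc d => rfl

lemma IsOfDegree.add {m : ℤ} {α β : Forms E M} (hα : IsOfDegree m α) (hβ : IsOfDegree m β) :
    IsOfDegree m (α + β) := by
  cases m with
  | ofNat d => exact fun x => add_mem (hα x) (hβ x)
  | negSucc d =>
    change α + β = 0
    rw [show α = 0 from hα, show β = 0 from hβ, add_zero]

lemma IsOfDegree.sub {m : ℤ} {α β : Forms E M} (hα : IsOfDegree m α) (hβ : IsOfDegree m β) :
    IsOfDegree m (α - β) := by
  cases m with
  | ofNat d => exact fun x => sub_mem (hα x) (hβ x)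
  | negSucc d =>
    change α - β = 0
    rw [show α = 0 from hα, show β = 0 from hβ, sub_zero]

lemma IsOfDegree.exteriorDerivative {m : ℤ} {α : Forms E M} (hα : IsOfDegree m α) :
    IsOfDegree (m + 1) (exteriorDerivative α) := by
  cases m with
  | ofNat d => exact fun x => extD_mem_exteriorPower hα x
  | negSucc d =>
    rw [show α = 0 from hα, map_zero]
    exact isOfDegree_zero _

lemma IsOfDegree.formInsertion {m : ℤ} {α : Forms E M} (hα : IsOfDegree m α) :
    IsOfDegree (m - 2) (formInsertion w α) := by
  cases m with
  | ofNat d =>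
    -- Below degree 2 the target degree is negative, where only the zero form is allowed, so the
    -- vanishing clause of `bivectorInsertion_mem` is required.
    by_cases hd : d < 2
    · have h : QuantumDeRham.formInsertion w α = 0 :=
        Subtype.ext (funext fun x => (bivectorInsertion_mem (w.toFun x) d (hα x)).2 hd)
      rw [h]
      exact isOfDegree_zero _
    · obtain ⟨p, rfl⟩ := Nat.exists_eq_add_of_le' (not_lt.1 hd)
      have h : Int.ofNat (p + 2) - 2 = Int.ofNat p := by simp
      rw [h]
      exact fun x => (bivectorInsertion_mem (w.toFun x) (p + 2) (hα x)).1
  | negSucc d =>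
    rw [show α = 0 from hα, map_zero]
    exact isOfDegree_zero _

lemma IsOfDegree.codifferential {m : ℤ} {α : Forms E M} (hα : IsOfDegree m α) :
    IsOfDegree (m - 1) (codifferential w α) := by
  have h1 : IsOfDegree (m + 1 - 2) (QuantumDeRham.formInsertion w (QuantumDeRham.exteriorDerivative α)) :=
    hα.exteriorDerivative.formInsertion
  have h2 : IsOfDegree (m - 2 + 1) (QuantumDeRham.exteriorDerivative (QuantumDeRham.formInsertion w α)) :=
    hα.formInsertion.exteriorDerivative
  rw [show m + 1 - 2 = m - 1 by ring] at h1
  rw [show m - 2 + 1 = m - 1 by ring] at h2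
  exact h1.sub h2

lemma IsOfDegree.formInvolution_eq {m : ℤ} {α : Forms E M} (hα : IsOfDegree m α) :
    formInvolution α = (-1 : ℝ) ^ m • α := by
  cases m with
  | ofNat d =>
    refine Subtype.ext (funext fun x => (gradeInvolution_of_mem (hα x)).trans ?_)
    rw [← zpow_natCast]
    rfl
  | negSucc d => rw [show α = 0 from hα, map_zero, smul_zero]

end FormCalculus

end

end QuantumDeRham

namespace QuantumDeRham

noncomputable section

/-! ### Extension of maps to polynomials and Laurent polynomials in h. -/

section HomogeneousExtension

variable {R A : Type*} [CommSemiring R] [Semiring A] [Algebra R A]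

/-- The `h`-linear extension to `A[h]` of the map `a ↦ f a + h g a` on `A`. -/
def polyExtension (f g : A →ₗ[R] A) : A[X] →ₗ[R] A[X] where
  toFun p := p.sum fun i a => monomial i (f a) + monomial (i + 1) (g a)
  map_add' p q := Polynomial.sum_add_index _ _ _ (fun i => by simp) fun i a b => by
    simp only [map_add]
    abel
  map_smul' r p := by
    rw [RingHom.id_apply, Polynomial.sum_smul_index' _ _ _ (fun i => by simp), Polynomial.sum_def,
      Polynomial.sum_def, Finset.smul_sum]
    simp only [map_smul, smul_add, smul_monomial]

lemma polyExtension_monomial (f g : A →ₗ[R] A) (i : ℕ) (a : A) :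
    polyExtension f g (monomial i a) = monomial i (f a) + monomial (i + 1) (g a) :=
  sum_monomial_index a (fun i a => monomial i (f a) + monomial (i + 1) (g a))
    (by rw [map_zero, map_zero, map_zero, map_zero, add_zero])

lemma toLaurent_smul (r : R) (p : A[X]) : toLaurent (r • p) = r • toLaurent p := by
  have h : r • p = C (algebraMap R A r) * p := by
    ext1 k
    rw [coeff_smul, coeff_C_mul, Algebra.smul_def]
  rw [h, toLaurent_C_mul_eq, Algebra.smul_def]
  rfl

lemma smul_mul_T (r : R) (p : A[T;T⁻¹]) (n : ℤ) :
    (r • p) * LaurentPolynomial.T n = r • (p * LaurentPolynomial.T n) :=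
  smul_mul_assoc _ _ _

/-- The extension to `A[h, h⁻¹]` of an `h`-linear map on `A[h]`. -/
def laurentExtension (F : A[X] →ₗ[R] A[X]) : A[T;T⁻¹] →ₗ[R] A[T;T⁻¹] where
  toFun p := p.coeff.sum fun i a => toLaurent (F (C a)) * LaurentPolynomial.T i
  map_add' p q := by
    rw [AddMonoidAlgebra.coeff_add]
    exact Finsupp.sum_add_index' (by simp) (by simp [add_mul])
  map_smul' r p := by
    rw [AddMonoidAlgebra.coeff_smul, Finsupp.sum_smul_index' (by simp), RingHom.id_apply,
      Finsupp.smul_sum]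
    refine Finsupp.sum_congr fun i _ => ?_
    rw [← smul_C, map_smul, toLaurent_smul, smul_mul_assoc]

lemma laurentExtension_C_mul_T (F : A[X] →ₗ[R] A[X]) (n : ℤ) (a : A) :
    laurentExtension F (LaurentPolynomial.C a * LaurentPolynomial.T n) =
      toLaurent (F (C a)) * LaurentPolynomial.T n := by
  rw [← LaurentPolynomial.single_eq_C_mul_T]
  exact Finsupp.sum_single_index
    (h := fun i a => toLaurent (F (C a)) * LaurentPolynomial.T i)
    (by rw [C_0, map_zero, map_zero, zero_mul])

end HomogeneousExtension

/-! ### The quantum differential on Ω(M)[h]. -/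

section PolynomialForms

set_option linter.unusedSectionVars false

variable {E : Type*} [NormedAddCommGroup E] [NormedSpace ℝ E] [FiniteDimensional ℝ E]
  {M : Type*} [TopologicalSpace M] [ChartedSpace E M] [IsManifold 𝓘(ℝ, E) ∞ M]
  (w : BivectorField E M)

/-- The `ℝ[h]`-linear extension of the quantum differential to `Ω(M)[h]`. -/
def polyD : (Forms E M)[X] →ₗ[ℝ] (Forms E M)[X] :=
  polyExtension exteriorDerivative (codifferential w)

lemma polyD_monomial (i : ℕ) (α : Forms E M) :
    polyD w (monomial i α) =
      monomial i (exteriorDerivative α) + monomial (i + 1) (codifferential w α) :=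
  polyExtension_monomial _ _ _ _

lemma polyD_coeff_zero (p : (Forms E M)[X]) :
    (polyD w p).coeff 0 = exteriorDerivative (p.coeff 0) := by
  induction p using Polynomial.induction_on' with
  | add p q hp hq => rw [map_add, coeff_add, hp, hq, coeff_add, map_add]
  | monomial i α =>
    rw [polyD_monomial, coeff_add, coeff_monomial, coeff_monomial, coeff_monomial]
    split_ifs <;> simp_all

lemma polyD_coeff_succ (p : (Forms E M)[X]) (k : ℕ) :
    (polyD w p).coeff (k + 1) =
      exteriorDerivative (p.coeff (k + 1)) + codifferential w (p.coeff k) := by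
  induction p using Polynomial.induction_on' with
  | add p q hp hq =>
    simp only [map_add, coeff_add, hp, hq]
    abel
  | monomial i α =>
    simp only [polyD_monomial, coeff_add, coeff_monomial, add_left_inj]
    split_ifs <;> simp

lemma polyD_mul_X_pow (p : (Forms E M)[X]) (n : ℕ) : polyD w (p * X ^ n) = polyD w p * X ^ n := by
  induction p using Polynomial.induction_on' with
  | add p q hp hq => simp only [map_add, add_mul, hp, hq]
  | monomial i α =>
    rw [monomial_mul_X_pow, polyD_monomial, polyD_monomial, add_mul, monomial_mul_X_pow,
      monomial_mul_X_pow, add_right_comm]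

lemma polyD_X_mul (p : (Forms E M)[X]) : polyD w (X * p) = X * polyD w p := by
  rw [X_mul, X_mul]
  simpa using polyD_mul_X_pow w p 1

variable {w} in
-- The coefficients of (d + hδ)² are d², dδ + δd and δ².
lemma polyD_polyD
    (hΛ : ∀ α, formInsertion w (codifferential w α) = codifferential w (formInsertion w α))
    (p : (Forms E M)[X]) : polyD w (polyD w p) = 0 := by
  ext1 k
  rcases k with _ | _ | k
  · rw [polyD_coeff_zero, polyD_coeff_zero, exteriorDerivative_exteriorDerivative, coeff_zero]
  · rw [polyD_coeff_succ, polyD_coeff_succ, polyD_coeff_zero, map_add,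
      exteriorDerivative_exteriorDerivative, exteriorDerivative_codifferential, coeff_zero]
    abel
  · rw [polyD_coeff_succ, polyD_coeff_succ, polyD_coeff_succ, map_add, map_add,
      exteriorDerivative_exteriorDerivative, exteriorDerivative_codifferential,
      codifferential_codifferential hΛ, coeff_zero]
    abel

/-- The grade involution of `Ω(M)[h]`. -/
def polyInvolution : (Forms E M)[X] →ₗ[ℝ] (Forms E M)[X] :=
  polyExtension formInvolution 0

lemma polyInvolution_monomial (i : ℕ) (α : Forms E M) :
    polyInvolution (monomial i α) = monomial i (formInvolution α) := by
  rw [polyInvolution, polyExtension_monomial, LinearMap.zero_apply, map_zero, add_zero]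

lemma polyInvolution_coeff (p : (Forms E M)[X]) (k : ℕ) :
    (polyInvolution p).coeff k = formInvolution (p.coeff k) := by
  induction p using Polynomial.induction_on' with
  | add p q hp hq => simp only [map_add, coeff_add, hp, hq]
  | monomial i α =>
    simp only [polyInvolution_monomial, coeff_monomial]
    split_ifs <;> simp

lemma neg_one_zpow_sub_two_mul (m k : ℤ) : (-1 : ℝ) ^ (m - 2 * k) = (-1 : ℝ) ^ m := by
  rw [zpow_sub₀ (by norm_num), zpow_mul]
  norm_num

/-- Since h has even degree, all coefficients of a homogeneous element have form degrees of the same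
parity as `m`. -/
lemma IsPolyHomogeneous.polyInvolution_eq {m : ℤ} {p : (Forms E M)[X]}
    (hp : IsPolyHomogeneous m p) : polyInvolution p = (-1 : ℝ) ^ m • p := by
  ext1 k
  rw [polyInvolution_coeff, (hp k).formInvolution_eq, neg_one_zpow_sub_two_mul, coeff_smul]

lemma IsPolyHomogeneous.polyD {m : ℤ} {p : (Forms E M)[X]} (hp : IsPolyHomogeneous m p) :
    IsPolyHomogeneous (m + 1) (polyD w p) := by
  intro k
  cases k with
  | zero =>
    rw [polyD_coeff_zero]
    have h := (hp 0).exteriorDerivative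
    simpa using h
  | succ k =>
    rw [polyD_coeff_succ]
    have h1 := (hp (k + 1)).exteriorDerivative
    have h2 := (hp k).codifferential (w := w)
    rw [show m - 2 * ((k + 1 : ℕ) : ℤ) + 1 = m + 1 - 2 * ((k + 1 : ℕ) : ℤ) by ring] at h1
    rw [show m - 2 * (k : ℤ) - 1 = m + 1 - 2 * ((k + 1 : ℕ) : ℤ) by push_cast; ring] at h2
    exact h1.add h2

/-! ### Bilinearity of the quantum exterior product -/

lemma formWedge_add_left (α α' β : Forms E M) :
    formWedge w (α + α') β = formWedge w α β + formWedge w α' β := by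
  ext1 k
  simp only [coeff_add, formWedge_coeff, map_add, LinearMap.add_apply]

lemma formWedge_add_right (α β β' : Forms E M) :
    formWedge w α (β + β') = formWedge w α β + formWedge w α β' := by
  ext1 k
  simp only [coeff_add, formWedge_coeff, map_add]

lemma formWedge_zero_left (β : Forms E M) : formWedge w 0 β = 0 := by
  ext1 k
  simp only [coeff_zero, formWedge_coeff, map_zero, LinearMap.zero_apply]

lemma formWedge_zero_right (α : Forms E M) : formWedge w α 0 = 0 := by
  ext1 k
  simp only [coeff_zero, formWedge_coeff, map_zero]

lemma formWedge_smul_left (r : ℝ) (α β : Forms E M) :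
    formWedge w (r • α) β = r • formWedge w α β := by
  ext1 k
  simp only [coeff_smul, formWedge_coeff, map_smul, LinearMap.smul_apply]

lemma polyWedge_add_left (p p' q : (Forms E M)[X]) :
    polyWedge w (p + p') q = polyWedge w p q + polyWedge w p' q := by
  unfold polyWedge
  refine Polynomial.sum_add_index _ _ _ (fun i => ?_) fun i α α' => ?_
  · simp only [formWedge_zero_left, zero_mul, Polynomial.sum_def, Finset.sum_const_zero]
  · simp only [formWedge_add_left, add_mul, Polynomial.sum_def, Finset.sum_add_distrib]

lemma polyWedge_add_right (p q q' : (Forms E M)[X]) :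
    polyWedge w p (q + q') = polyWedge w p q + polyWedge w p q' := by
  unfold polyWedge
  rw [← Polynomial.sum_add']
  congr 1
  funext i α
  refine Polynomial.sum_add_index _ _ _ (fun j => ?_) fun j β β' => ?_
  · simp [formWedge_zero_right]
  · simp only [formWedge_add_right, add_mul]

lemma polyWedge_monomial (i j : ℕ) (α β : Forms E M) :
    polyWedge w (monomial i α) (monomial j β) = formWedge w α β * X ^ (i + j) := by
  unfold polyWedge
  rw [sum_monomial_index, sum_monomial_index]
  · rw [formWedge_zero_right, zero_mul]
  · simp only [formWedge_zero_left, zero_mul, Polynomial.sum_def, Finset.sum_const_zero]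

lemma polyWedge_smul_left (r : ℝ) (p q : (Forms E M)[X]) :
    polyWedge w (r • p) q = r • polyWedge w p q := by
  induction p using Polynomial.induction_on' with
  | add p p' hp hp' => rw [smul_add, polyWedge_add_left, polyWedge_add_left, smul_add, hp, hp']
  | monomial i α =>
    induction q using Polynomial.induction_on' with
    | add q q' hq hq' => rw [polyWedge_add_right, polyWedge_add_right, smul_add, hq, hq']
    | monomial j β =>
      rw [smul_monomial, polyWedge_monomial, polyWedge_monomial, formWedge_smul_left,
        smul_mul_assoc]

/-- `formWedgeCoeff_leibniz` collected into one identity of polynomials; the factor `X` accounts for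
the index shift of `formWedgeCoeffPred`. -/
lemma polyD_formWedge
    (hΛ : ∀ α, formInsertion w (codifferential w α) = codifferential w (formInsertion w α))
    (α β : Forms E M) :
    polyD w (formWedge w α β) =
      formWedge w (exteriorDerivative α) β + formWedge w (codifferential w α) β * X +
        formWedge w (formInvolution α) (exteriorDerivative β) +
        formWedge w (formInvolution α) (codifferential w β) * X := by
  ext1 k
  have h := formWedgeCoeff_leibniz hΛ k α β
  cases k with
  | zero =>
    simpa [polyD_coeff_zero, formWedge_coeff, mul_coeff_zero, formWedgeCoeffPred] using h
  | succ k =>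
    simpa [polyD_coeff_succ, formWedge_coeff, coeff_mul_X, formWedgeCoeffPred] using h

-- With the involution in place of a sign, the Leibniz rule needs no homogeneity and is additive in
-- both arguments, so it suffices to check monomials.
set_option maxHeartbeats 1000000 in
lemma polyD_polyWedge
    (hΛ : ∀ α, formInsertion w (codifferential w α) = codifferential w (formInsertion w α))
    (p q : (Forms E M)[X]) :
    polyD w (polyWedge w p q) =
      polyWedge w (polyD w p) q + polyWedge w (polyInvolution p) (polyD w q) := by
  induction p using Polynomial.induction_on' with
  | add p p' hp hp' =>
    simp only [polyWedge_add_left, map_add, hp, hp']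
    abel
  | monomial i α =>
    induction q using Polynomial.induction_on' with
    | add q q' hq hq' =>
      simp only [polyWedge_add_right, map_add, hq, hq']
      abel
    | monomial j β =>
      rw [polyWedge_monomial, polyD_mul_X_pow, polyD_formWedge w hΛ, polyD_monomial,
        polyD_monomial, polyInvolution_monomial i α, polyWedge_add_left, polyWedge_add_right,
        polyWedge_monomial, polyWedge_monomial, polyWedge_monomial, polyWedge_monomial,
        add_mul, add_mul, add_mul, mul_assoc, mul_assoc, ← pow_succ', ← add_assoc,
        add_right_comm i 1 j, add_assoc i j 1]

lemma polyD_polyWedge_of_isPolyHomogeneous {w : BivectorField E M}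
    (hΛ : ∀ α, formInsertion w (codifferential w α) = codifferential w (formInsertion w α))
    {m : ℤ} {p : (Forms E M)[X]} (hp : IsPolyHomogeneous m p) (q : (Forms E M)[X]) :
    polyD w (polyWedge w p q) =
      polyWedge w (polyD w p) q + ((-1 : ℝ) ^ m) • polyWedge w p (polyD w q) := by
  rw [polyD_polyWedge w hΛ, hp.polyInvolution_eq, polyWedge_smul_left]

variable {w} {cov : CovariantDerivative 𝓘(ℝ, E) E (TangentSpace 𝓘(ℝ, E) : M → Type _)}

lemma polyD_C_coeff_zero (α : Forms E M) :
    (polyD w (C α)).coeff 0 = exteriorDerivative α := by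
  rw [polyD_coeff_zero, coeff_C_zero]

lemma polyD_C_coeff_one (α : Forms E M) :
    (polyD w (C α)).coeff 1 = codifferential w α := by
  rw [polyD_coeff_succ w _ 0, coeff_C_zero, coeff_C_succ, map_zero, zero_add]

lemma polyD_C_coeff_add_two (α : Forms E M) (k : ℕ) :
    (polyD w (C α)).coeff (k + 2) = 0 := by
  rw [polyD_coeff_succ, coeff_C_succ, coeff_C_succ, map_zero, map_zero, add_zero]

/-- The left side does not involve `e`: this is both the smoothness of d_h α and its independence of
the basis. -/
lemma map_polyD_C (htorsion : cov.torsion = 0) (hparallel : w.IsParallel cov)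
    (α : Forms E M) (x : M) {ι : Type*} [Fintype ι] (e : Basis ι ℝ (TangentSpace 𝓘(ℝ, E) x)) :
    (polyD w (C α)).map (valueAt E x) = quantumDifferentialAt w cov α x e := by
  have h (k : ℕ) : valueAt E x ((polyD w (C α)).coeff k) =
      (quantumDifferentialAt w cov α x e).coeff k := by
    rcases k with _ | _ | k
    · rw [polyD_C_coeff_zero]
      exact (quantumDifferentialAt_coeff_zero htorsion α x e).symm
    · rw [zero_add, polyD_C_coeff_one]
      exact (quantumDifferentialAt_coeff_one htorsion hparallel α x e).symm
    · rw [polyD_C_coeff_add_two, map_zero]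
      exact (quantumDifferentialAt_coeff_add_two α x k e).symm
  ext1 k
  rw [coeff_map, h]

end PolynomialForms

/-! ### The quantum differential on Ω(M)[h, h⁻¹], by clearing denominators. -/

section LaurentForms

set_option linter.unusedSectionVars false

variable {E : Type*} [NormedAddCommGroup E] [NormedSpace ℝ E] [FiniteDimensional ℝ E]
  {M : Type*} [TopologicalSpace M] [ChartedSpace E M] [IsManifold 𝓘(ℝ, E) ∞ M]
  (w : BivectorField E M)

lemma laurent_coeff_mul_T {A : Type*} [Semiring A] (p : A[T;T⁻¹]) (n k : ℤ) :
    (p * LaurentPolynomial.T n).coeff k = p.coeff (k - n) := by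
  induction p using LaurentPolynomial.induction_on' with
  | add p q hp hq =>
    rw [add_mul, AddMonoidAlgebra.coeff_add, AddMonoidAlgebra.coeff_add, Finsupp.add_apply,
      Finsupp.add_apply, hp, hq]
  | C_mul_T m a =>
    rw [mul_assoc, ← LaurentPolynomial.T_add, ← LaurentPolynomial.single_eq_C_mul_T,
      ← LaurentPolynomial.single_eq_C_mul_T, AddMonoidAlgebra.coeff_single,
      AddMonoidAlgebra.coeff_single, Finsupp.single_apply, Finsupp.single_apply]
    simp only [eq_sub_iff_add_eq]

lemma toLaurent_coeff_natCast {A : Type*} [Semiring A] (p : A[X]) (k : ℕ) :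
    (toLaurent p).coeff (k : ℤ) = p.coeff k := by
  rw [LaurentPolynomial.coeff_toLaurent]
  exact Finsupp.mapDomain_apply Nat.castEmbedding.injective _ _

lemma toLaurent_coeff_negSucc {A : Type*} [Semiring A] (p : A[X]) (k : ℕ) :
    (toLaurent p).coeff (Int.negSucc k) = 0 := by
  rw [LaurentPolynomial.coeff_toLaurent]
  refine Finsupp.mapDomain_of_notMem_range _ _ ?_
  rintro ⟨n, hn⟩
  simp at hn

lemma mul_T_left_injective {A : Type*} [Semiring A] (n : ℤ) {p q : A[T;T⁻¹]}
    (h : p * LaurentPolynomial.T n = q * LaurentPolynomial.T n) : p = q :=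
  (LaurentPolynomial.isUnit_T n).mul_right_cancel h

/-- The `ℝ[h, h⁻¹]`-linear extension of the quantum differential to `Ω(M)[h, h⁻¹]`. -/
def laurentD : (Forms E M)[T;T⁻¹] →ₗ[ℝ] (Forms E M)[T;T⁻¹] :=
  laurentExtension (polyD w)

lemma laurentD_C_mul_T (n : ℤ) (α : Forms E M) :
    laurentD w (LaurentPolynomial.C α * LaurentPolynomial.T n) =
      toLaurent (polyD w (C α)) * LaurentPolynomial.T n :=
  laurentExtension_C_mul_T _ _ _

lemma laurentD_mul_T (p : (Forms E M)[T;T⁻¹]) (n : ℤ) :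
    laurentD w (p * LaurentPolynomial.T n) = laurentD w p * LaurentPolynomial.T n := by
  induction p using LaurentPolynomial.induction_on' with
  | add p q hp hq => simp only [map_add, add_mul, hp, hq]
  | C_mul_T m a =>
    rw [mul_assoc, ← LaurentPolynomial.T_add, laurentD_C_mul_T, laurentD_C_mul_T, mul_assoc,
      LaurentPolynomial.T_add]

lemma laurentD_toLaurent (p : (Forms E M)[X]) :
    laurentD w (toLaurent p) = toLaurent (polyD w p) := by
  induction p using Polynomial.induction_on' with
  | add p q hp hq => simp only [map_add, hp, hq]
  | monomial n α =>
    rw [toLaurent_C_mul_T, laurentD_C_mul_T, ← C_mul_X_pow_eq_monomial, polyD_mul_X_pow, map_mul,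
      toLaurent_X_pow]

lemma laurentWedge_add_left (p p' q : (Forms E M)[T;T⁻¹]) :
    laurentWedge w (p + p') q = laurentWedge w p q + laurentWedge w p' q := by
  unfold laurentWedge
  rw [AddMonoidAlgebra.coeff_add]
  refine Finsupp.sum_add_index' (fun i => ?_) fun i α α' => ?_
  · simp [formWedge_zero_left]
  · rw [← Finsupp.sum_add]
    simp only [formWedge_add_left, map_add, add_mul]

lemma laurentWedge_add_right (p q q' : (Forms E M)[T;T⁻¹]) :
    laurentWedge w p (q + q') = laurentWedge w p q + laurentWedge w p q' := by
  unfold laurentWedge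
  rw [← Finsupp.sum_add]
  refine Finsupp.sum_congr fun i _ => ?_
  rw [AddMonoidAlgebra.coeff_add]
  refine Finsupp.sum_add_index' (fun j => ?_) fun j β β' => ?_
  · simp [formWedge_zero_right]
  · simp only [formWedge_add_right, map_add, add_mul]

lemma laurentWedge_C_mul_T (i j : ℤ) (α β : Forms E M) :
    laurentWedge w (LaurentPolynomial.C α * LaurentPolynomial.T i)
      (LaurentPolynomial.C β * LaurentPolynomial.T j) =
      toLaurent (formWedge w α β) * LaurentPolynomial.T (i + j) := by
  rw [← LaurentPolynomial.single_eq_C_mul_T, ← LaurentPolynomial.single_eq_C_mul_T]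
  unfold laurentWedge
  rw [AddMonoidAlgebra.coeff_single, AddMonoidAlgebra.coeff_single, Finsupp.sum_single_index,
    Finsupp.sum_single_index]
  · rw [formWedge_zero_right, map_zero, zero_mul]
  · simp [formWedge_zero_left]

lemma laurentWedge_mul_T (p q : (Forms E M)[T;T⁻¹]) (m n : ℤ) :
    laurentWedge w (p * LaurentPolynomial.T m) (q * LaurentPolynomial.T n) =
      laurentWedge w p q * LaurentPolynomial.T (m + n) := by
  induction p using LaurentPolynomial.induction_on' with
  | add p p' hp hp' => simp only [laurentWedge_add_left, add_mul, hp, hp']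
  | C_mul_T i α =>
    induction q using LaurentPolynomial.induction_on' with
    | add q q' hq hq' => simp only [laurentWedge_add_right, add_mul, hq, hq']
    | C_mul_T j β =>
      rw [mul_assoc, mul_assoc, ← LaurentPolynomial.T_add, ← LaurentPolynomial.T_add,
        laurentWedge_C_mul_T, laurentWedge_C_mul_T, mul_assoc, ← LaurentPolynomial.T_add,
        add_add_add_comm]

lemma laurentWedge_toLaurent (p q : (Forms E M)[X]) :
    laurentWedge w (toLaurent p) (toLaurent q) = toLaurent (polyWedge w p q) := by
  induction p using Polynomial.induction_on' with
  | add p p' hp hp' => simp only [map_add, laurentWedge_add_left, polyWedge_add_left, hp, hp']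
  | monomial i α =>
    induction q using Polynomial.induction_on' with
    | add q q' hq hq' => simp only [map_add, laurentWedge_add_right, polyWedge_add_right, hq, hq']
    | monomial j β =>
      rw [toLaurent_C_mul_T, toLaurent_C_mul_T, laurentWedge_C_mul_T, polyWedge_monomial, map_mul,
        toLaurent_X_pow, Nat.cast_add]

lemma isLaurentHomogeneous_toLaurent {m : ℤ} {p : (Forms E M)[X]} :
    IsLaurentHomogeneous m (toLaurent p) ↔ IsPolyHomogeneous m p := by
  refine ⟨fun h k => ?_, fun h k => ?_⟩
  · simpa only [toLaurent_coeff_natCast] using h k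
  · cases k with
    | ofNat k => simpa only [Int.ofNat_eq_natCast, toLaurent_coeff_natCast] using h k
    | negSucc k =>
      rw [toLaurent_coeff_negSucc]
      exact isOfDegree_zero _

lemma IsLaurentHomogeneous.mul_T {m : ℤ} {p : (Forms E M)[T;T⁻¹]}
    (hp : IsLaurentHomogeneous m p) (n : ℤ) :
    IsLaurentHomogeneous (m + 2 * n) (p * LaurentPolynomial.T n) := by
  intro k
  rw [laurent_coeff_mul_T, show m + 2 * n - 2 * k = m - 2 * (k - n) by ring]
  exact hp (k - n)

lemma IsLaurentHomogeneous.laurentD {m : ℤ} {p : (Forms E M)[T;T⁻¹]}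
    (hp : IsLaurentHomogeneous m p) : IsLaurentHomogeneous (m + 1) (laurentD w p) := by
  -- Multiplication by Tⁿ makes `p` a polynomial and shifts its degree by 2n; multiplication by T⁻ⁿ
  -- undoes this at the end.
  obtain ⟨n, p', hp'⟩ := p.exists_T_pow
  have h1 := hp.mul_T n
  rw [← hp', isLaurentHomogeneous_toLaurent] at h1
  have h2 := (isLaurentHomogeneous_toLaurent.2 (h1.polyD w)).mul_T (-n)
  rw [← laurentD_toLaurent, hp', laurentD_mul_T, mul_assoc, ← LaurentPolynomial.T_add,
    add_neg_cancel, LaurentPolynomial.T_zero, mul_one,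
    show m + 2 * (n : ℤ) + 1 + 2 * -(n : ℤ) = m + 1 by ring] at h2
  exact h2

variable {w}

lemma laurentD_laurentD
    (hΛ : ∀ α, formInsertion w (codifferential w α) = codifferential w (formInsertion w α))
    (p : (Forms E M)[T;T⁻¹]) : laurentD w (laurentD w p) = 0 := by
  obtain ⟨n, p', hp'⟩ := p.exists_T_pow
  refine mul_T_left_injective n ?_
  rw [← laurentD_mul_T, ← laurentD_mul_T, ← hp', laurentD_toLaurent, laurentD_toLaurent,
    polyD_polyD hΛ, map_zero, zero_mul]

set_option maxHeartbeats 1000000 in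
lemma laurentD_laurentWedge
    (hΛ : ∀ α, formInsertion w (codifferential w α) = codifferential w (formInsertion w α))
    {m : ℤ} {p : (Forms E M)[T;T⁻¹]} (hp : IsLaurentHomogeneous m p) (q : (Forms E M)[T;T⁻¹]) :
    laurentD w (laurentWedge w p q) =
      laurentWedge w (laurentD w p) q + ((-1 : ℝ) ^ m) • laurentWedge w p (laurentD w q) := by
  obtain ⟨n, p', hp'⟩ := p.exists_T_pow
  obtain ⟨k, q', hq'⟩ := q.exists_T_pow
  have h1 := hp.mul_T n
  rw [← hp', isLaurentHomogeneous_toLaurent] at h1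
  -- Clearing denominators changes the degree of `p` by an even number, so the Leibniz sign stays
  -- the same.
  have hsign : (-1 : ℝ) ^ (m + 2 * (n : ℤ)) = (-1 : ℝ) ^ m := by
    rw [← neg_one_zpow_sub_two_mul _ (n : ℤ), add_sub_cancel_right]
  refine mul_T_left_injective ((n : ℤ) + k) ?_
  have h3 := congrArg toLaurent (polyD_polyWedge_of_isPolyHomogeneous hΛ h1 q')
  rw [hsign, map_add, toLaurent_smul, ← laurentD_toLaurent, ← laurentWedge_toLaurent,
    ← laurentWedge_toLaurent, ← laurentWedge_toLaurent, ← laurentD_toLaurent,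
    ← laurentD_toLaurent, hp', hq', laurentD_mul_T, laurentD_mul_T, laurentWedge_mul_T,
    laurentWedge_mul_T, laurentWedge_mul_T, laurentD_mul_T] at h3
  rw [h3, add_mul, smul_mul_T]

end LaurentForms

end

end QuantumDeRham

theorem theorem2p1 {n : ℕ} {M : Type*} [TopologicalSpace M] [T2Space M]
    [SecondCountableTopology M] [ChartedSpace (EuclideanSpace ℝ (Fin n)) M]
    [IsManifold 𝓘(ℝ, EuclideanSpace ℝ (Fin n)) ∞ M]
    (w : BivectorField (EuclideanSpace ℝ (Fin n)) M)
    (cov : CovariantDerivative 𝓘(ℝ, EuclideanSpace ℝ (Fin n)) (EuclideanSpace ℝ (Fin n))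
      (TangentSpace 𝓘(ℝ, EuclideanSpace ℝ (Fin n)) : M → Type _))
    (hsmooth : CovariantDerivative.ContMDiffCovariantDerivative cov ∞)
    (htorsion : cov.torsion = 0) (hparallel : w.IsParallel cov) :
    ∃ (D : (Forms (EuclideanSpace ℝ (Fin n)) M)[X] →ₗ[ℝ]
          (Forms (EuclideanSpace ℝ (Fin n)) M)[X])
      (L : (Forms (EuclideanSpace ℝ (Fin n)) M)[T;T⁻¹] →ₗ[ℝ]
          (Forms (EuclideanSpace ℝ (Fin n)) M)[T;T⁻¹]),
      -- `D` and `L` are the `h`-linear extensions of `d_h`, in any basis of any tangent space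
      (∀ (α : Forms (EuclideanSpace ℝ (Fin n)) M) (x : M)
        (e : Module.Basis (Fin n) ℝ (TangentSpace 𝓘(ℝ, EuclideanSpace ℝ (Fin n)) x)),
        (D (C α)).map (valueAt (EuclideanSpace ℝ (Fin n)) x) =
          quantumDifferentialAt w cov α x e) ∧
      (∀ p, D (X * p) = X * D p) ∧
      (∀ p, L (toLaurent p) = toLaurent (D p)) ∧
      (∀ (k : ℤ) p, L (LaurentPolynomial.T k * p) = LaurentPolynomial.T k * L p) ∧
      -- `D` and `L` are graded derivations (of degree one) of the quantum exterior product
      (∀ (m : ℤ) p, IsPolyHomogeneous m p →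
        IsPolyHomogeneous (m + 1) (D p)) ∧
      (∀ (m : ℤ) p, IsLaurentHomogeneous m p →
        IsLaurentHomogeneous (m + 1) (L p)) ∧
      (∀ (m : ℤ) p q, IsPolyHomogeneous m p →
        D (polyWedge w p q) =
          polyWedge w (D p) q +
            ((-1 : ℝ) ^ m) • polyWedge w p (D q)) ∧
      (∀ (m : ℤ) p q, IsLaurentHomogeneous m p →
        L (laurentWedge w p q) =
          laurentWedge w (L p) q +
            ((-1 : ℝ) ^ m) • laurentWedge w p (L q)) ∧
      -- `D` and `L` have square zero
      (∀ p, D (D p) = 0) ∧ (∀ p, L (L p) = 0) := by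
  -- The Leibniz rule and the vanishing of the square for d + h[Λ, d] need only [Λ, δ] = 0; the
  -- geometric hypotheses enter once more to identify this operator with d_h.
  have hΛ := formInsertion_codifferential htorsion hparallel
  refine ⟨polyD w, laurentD w, fun α x e => map_polyD_C htorsion hparallel α x e, polyD_X_mul w,
    laurentD_toLaurent w, fun k p => ?_, fun m p hp => hp.polyD w, fun m p hp => hp.laurentD w,
    fun m p q hp => polyD_polyWedge_of_isPolyHomogeneous hΛ hp q,
    fun m p q hp => laurentD_laurentWedge hΛ hp q, polyD_polyD hΛ, laurentD_laurentD hΛ⟩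
  rw [LaurentPolynomial.T_mul, LaurentPolynomial.T_mul, laurentD_mul_T]
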